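/- Let $d\ge 0$ be an integer and let $V$ be a complex Banach space (for instance $V=\mathbb{C}$). For $h>0$ and $(x,\xi)\in\mathbb{R}^d\times\mathbb{R}^d$ put $$k_{h,x,\xi}(y)=e^{-\frac{1}{2h}(x-y)^2}e^{\frac{\mathrm{i}}{h}(x-y)\cdot\xi},\qquad \alpha_h=2^{-\frac d2}(\pi h)^{-\frac{3d}{4}}.$$ The semi-classical FBI transform is $(T_hf)(x,\xi)=\alpha_h\int_{\mathbb{R}^d}k_{h,x,\xi}(y)f(y)\,\mathrm{d}y$ for $f\in\mathcal{S}(\mathbb{R}^d)$, and $(T_hu)(x,\xi)=\alpha_h\,u(k_{h,x,\xi})$ for a $V$-valued tempered distribution $u\in\mathcal{S}'(\mathbb{R}^d,V)$. All families are indexed by $h\in(0,1]$, and $\mathbb{R}^d\times\mathbb{R}^d$ carries the Euclidean distance. A family $(u_h)$ in $\mathcal{S}'(\mathbb{R}^d,V)$ is polynomially bounded if there are a continuous semi-norm $p$ on $\mathcal{S}(\mathbb{R}^d)$ and $N>0$ with $\|u_h(f)\|\le h^{-N}p(f)$ for all $f\in\mathcal{S}(\mathbb{R}^d)$ and $h\in(0,1]$.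 Its microsupport $\mu\mathrm{S}(u_h)\subset\mathbb{R}^d\times\mathbb{R}^d$ is the complement of the set of points $(x_0,\xi_0)$ for which there are $C,\delta>0$ and a neighbourhood $\mathcal{U}$ of $(x_0,\xi_0)$ such that $\|(T_hu_h)(x,\xi)\|<Ce^{-\delta h^{-1}}$ for all $(x,\xi)\in\mathcal{U}$ and $h\in(0,1]$. Let $C^\infty_{0,h}(\mathbb{R}^d)$ be the set of families $(f_h)$ of smooth functions $f_h:\mathbb{R}^d\to\mathbb{C}$ that are all supported in one compact set (independent of $h$) and such that for every Schwartz semi-norm $p$ there is $N>0$ with $p(f_h)=O(h^{-N})$ as $h\searrow0$. Such a family is uniformly microsupported in $K\subset\mathbb{R}^d\times\mathbb{R}^d$ if for every $\epsilon>0$ there is $\delta>0$ such that for every $N$ there is $C_N>0$ with $$(1+|x|^2+|\xi|^2)^N\,|(T_hf_h)(x,\xi)|\le C_Ne^{-\delta h^{-1}}$$ for all $h\in(0,1]$ and all $(x,\xi)$ with $\mathrm{dist}((x,\xi),K)>\epsilon$. **Proposition.** Let $(u_h)$ be a polynomially bounded family in $\mathcal{S}'(\mathbb{R}^d,V)$,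 and let $(x,\xi)\in\mathbb{R}^d\times\mathbb{R}^d$. Then $(x,-\xi)\notin\mu\mathrm{S}(u_h)$ if and only if there exists $\epsilon>0$ such that for every family $(f_h)\in C^\infty_{0,h}(\mathbb{R}^d)$ that is uniformly microsupported in the ball $B_\epsilon(x,\xi)$ there is $\delta>0$ with $\|u_h(f_h)\|=O(e^{-\delta h^{-1}})$ as $h\searrow0$. -/

import Mathlib

open scoped SchwartzMap ContDiff Topology

noncomputable section

namespace Microlocal

/-- Configuration space `ℝ^d` with its Euclidean structure. -/
abbrev Conf (d : ℕ) : Type := EuclideanSpace ℝ (Fin d)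

/-- Phase space `ℝ^d × ℝ^d` with the Euclidean distance of `ℝ^{2d}`;
a point `p` is the pair `(p.fst, p.snd) = (x, ξ)`. -/
abbrev Phase (d : ℕ) : Type := WithLp 2 (Conf d × Conf d)

/-- The point `(x, ξ)` of phase space. -/
def pt {d : ℕ} (x ξ : Conf d) : Phase d := WithLp.toLp 2 (x, ξ)

/-- The exponent `-(x - y)² / (2h) + (i / h) (x - y) · ξ` at `p = (x, ξ)`. -/
def fbiPhase {d : ℕ} (h : ℝ) (p : Phase d) (y : Conf d) : ℂ :=
  ((-(1 / (2 * h)) * ‖p.fst - y‖ ^ 2 : ℝ) : ℂ) +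
    ((1 / h * inner ℝ (p.fst - y) p.snd : ℝ) : ℂ) * Complex.I

theorem fbiPhase_hasTemperateGrowth {d : ℕ} (h : ℝ) (p : Phase d) :
    (fbiPhase h p).HasTemperateGrowth := by
  have h1 : (fun y : Conf d => p.fst - y).HasTemperateGrowth := by fun_prop
  have h2 : (fun y : Conf d => ‖p.fst - y‖ ^ 2).HasTemperateGrowth :=
    (Function.hasTemperateGrowth_norm_sq (H := Conf d)).comp h1
  have h3 : (fun y : Conf d => inner ℝ (p.fst - y) p.snd).HasTemperateGrowth :=
    (Function.hasTemperateGrowth_inner_left p.snd).comp h1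
  have h4 : (fun y : Conf d => ((-(1 / (2 * h)) * ‖p.fst - y‖ ^ 2 : ℝ) : ℂ)).HasTemperateGrowth :=
    Function.Complex.hasTemperateGrowth_ofReal.comp
      ((Function.HasTemperateGrowth.const (-(1 / (2 * h)))).mul h2)
  have h5 : (fun y : Conf d =>
      ((1 / h * inner ℝ (p.fst - y) p.snd : ℝ) : ℂ)).HasTemperateGrowth :=
    Function.Complex.hasTemperateGrowth_ofReal.comp
      ((Function.HasTemperateGrowth.const (1 / h)).mul h3)
  exact h4.add (h5.mul (Function.HasTemperateGrowth.const Complex.I))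

theorem norm_iteratedFDeriv_cexp_le (n : ℕ) (z : ℂ) :
    ‖iteratedFDeriv ℝ n Complex.exp z‖ ≤ ‖Complex.exp z‖ := by
  induction n with
  | zero => simp
  | succ n ih =>
    have hf : fderiv ℝ Complex.exp = (ContinuousLinearMap.mul ℝ ℂ) ∘ Complex.exp := by
      funext w
      have := (Complex.hasStrictFDerivAt_exp_real w).hasFDerivAt.fderiv
      rw [this]
      ext v
      simp
    rw [← norm_iteratedFDeriv_fderiv, hf]
    refine (ContinuousLinearMap.norm_iteratedFDeriv_comp_left (N := ∞) _
      (Complex.contDiff_exp.contDiffAt) (by exact_mod_cast le_top)).trans ?_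
    calc _ ≤ 1 * ‖iteratedFDeriv ℝ n Complex.exp z‖ := by
          gcongr
          exact ContinuousLinearMap.opNorm_mul_le ℝ ℂ
      _ ≤ _ := by simpa using ih

theorem pow_mul_gauss_bounded (a : ℝ) (ha : 0 < a) (r : ℝ) (hr : 0 ≤ r) (k : ℕ) :
    ∃ C : ℝ, ∀ t : ℝ, 0 ≤ t → (1 + r + t) ^ k * Real.exp (-a * t ^ 2) ≤ C := by
  refine ⟨k.factorial * Real.exp (1 / (4 * a) + 1 + r), fun t ht => ?_⟩
  have h1 : (1 + r + t) ^ k ≤ k.factorial * Real.exp (1 + r + t) := by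
    have := Real.pow_div_factorial_le_exp (1 + r + t) (by positivity) k
    rw [div_le_iff₀ (by positivity)] at this
    linarith
  have h2 : 1 + r + t + -a * t ^ 2 ≤ 1 / (4 * a) + 1 + r := by
    have h3 : 1 / (4 * a) - t + a * t ^ 2 = a * (t - 1 / (2 * a)) ^ 2 := by
      field_simp
      ring
    have h4 : 0 ≤ a * (t - 1 / (2 * a)) ^ 2 := by positivity
    linarith
  calc _ ≤ k.factorial * Real.exp (1 + r + t) * Real.exp (-a * t ^ 2) := by gcongr
    _ = k.factorial * Real.exp (1 + r + t + -a * t ^ 2) := by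
        rw [Real.exp_add (1 + r + t), mul_assoc]
    _ ≤ _ := by gcongr

theorem fbiKernel_decay {d : ℕ} (h : ℝ) (hh : 0 < h) (p : Phase d) (k n : ℕ) :
    ∃ C : ℝ, ∀ y : Conf d,
      ‖y‖ ^ k * ‖iteratedFDeriv ℝ n (fun y => Complex.exp (fbiPhase h p y)) y‖ ≤ C := by
  obtain ⟨l, C, hC, hgrowth⟩ := (fbiPhase_hasTemperateGrowth h p).norm_iteratedFDeriv_le_uniform n
  obtain ⟨B, hB⟩ := pow_mul_gauss_bounded (1 / (2 * h)) (by positivity) ‖p.fst‖ (norm_nonneg _)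
    (k + l * n)
  refine ⟨n.factorial * (C + 1) ^ n * B, fun y => ?_⟩
  have hD : ∀ i, 1 ≤ i → i ≤ n →
      ‖iteratedFDeriv ℝ i (fbiPhase h p) y‖ ≤ ((C + 1) * (1 + ‖y‖) ^ l) ^ i := by
    intro i hi hin
    have h1 : (1 : ℝ) ≤ (C + 1) * (1 + ‖y‖) ^ l :=
      one_le_mul_of_one_le_of_one_le (by linarith)
        (one_le_pow₀ (by linarith [norm_nonneg y]))
    calc _ ≤ C * (1 + ‖y‖) ^ l := hgrowth i hin y
      _ ≤ (C + 1) * (1 + ‖y‖) ^ l := by gcongr; linarith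
      _ ≤ _ := le_self_pow₀ h1 (by omega)
  have hmain := norm_iteratedFDeriv_comp_le (𝕜 := ℝ) (N := ∞) (g := Complex.exp) (f := fbiPhase h p)
    (n := n)
    (Complex.contDiff_exp) ((fbiPhase_hasTemperateGrowth h p).1) (by exact_mod_cast le_top) y
    (C := ‖Complex.exp (fbiPhase h p y)‖) (fun i _ => norm_iteratedFDeriv_cexp_le i _) hD
  have hnorm : ‖Complex.exp (fbiPhase h p y)‖ =
      Real.exp (-(1 / (2 * h)) * ‖p.fst - y‖ ^ 2) := by
    rw [Complex.norm_exp, fbiPhase]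
    simp only [Complex.add_re, Complex.ofReal_re, Complex.re_ofReal_mul, Complex.I_re, mul_zero,
      add_zero]
  have hy : ‖y‖ ≤ ‖p.fst‖ + ‖p.fst - y‖ := by
    have := norm_sub_le p.fst (p.fst - y)
    simpa using this
  have hB' := hB ‖p.fst - y‖ (norm_nonneg _)
  rw [← hnorm] at hB'
  calc _ ≤ ‖y‖ ^ k * (n.factorial * ‖Complex.exp (fbiPhase h p y)‖ *
        ((C + 1) * (1 + ‖y‖) ^ l) ^ n) := by
        gcongr
        exact hmain
    _ = n.factorial * (C + 1) ^ n *
        (‖y‖ ^ k * (1 + ‖y‖) ^ (l * n) * ‖Complex.exp (fbiPhase h p y)‖) := by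
        rw [mul_pow, ← pow_mul]; ring
    _ ≤ n.factorial * (C + 1) ^ n * ((1 + ‖p.fst‖ + ‖p.fst - y‖) ^ (k + l * n) *
        ‖Complex.exp (fbiPhase h p y)‖) := by
        rw [pow_add]
        have hy0 : ‖y‖ ≤ 1 + ‖p.fst‖ + ‖p.fst - y‖ := by linarith
        have hy1 : 1 + ‖y‖ ≤ 1 + ‖p.fst‖ + ‖p.fst - y‖ := by linarith
        gcongr
    _ ≤ _ := by gcongr

/-- For `h > 0` and `p = (x, ξ)`, the Schwartz function
`y ↦ exp (-(x - y)² / (2h)) exp ((i / h) (x - y) · ξ)`. -/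
def fbiKernel {d : ℕ} (h : ℝ) (hh : 0 < h) (p : Phase d) : 𝓢(Conf d, ℂ) where
  toFun y := Complex.exp (fbiPhase h p y)
  smooth' := Complex.contDiff_exp.comp (fbiPhase_hasTemperateGrowth h p).1
  decay' := fbiKernel_decay h hh p

/-- The normalisation `α_h = 2^{-d/2} (π h)^{-3d/4}`. -/
def fbiConst (d : ℕ) (h : ℝ) : ℝ :=
  (2 : ℝ) ^ (-(d : ℝ) / 2) * (Real.pi * h) ^ (-(3 * (d : ℝ)) / 4)

/-- The semi-classical FBI transform `T_h f` of a Schwartz function. -/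
def fbi {d : ℕ} (h : ℝ) (f : 𝓢(Conf d, ℂ)) (p : Phase d) : ℂ :=
  (fbiConst d h : ℂ) * ∫ y : Conf d, Complex.exp (fbiPhase h p y) * f y

/-- The semi-classical FBI transform `T_h u` of a (vector-valued) tempered distribution:
the integral against `u` is the pairing of `u` with the kernel. -/
def fbiDist {d : ℕ} {V : Type*} [NormedAddCommGroup V] [NormedSpace ℂ V]
    (h : ℝ) (hh : 0 < h) (u : 𝓢'(Conf d, V)) (p : Phase d) : V :=
  (fbiConst d h : ℂ) • u (fbiKernel h hh p)

/-- `(u_h) ∈ 𝓢'_h(ℝ^d)`: polynomially bounded families of tempered distributions. Families are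
indexed by `h ∈ (0, 1]`; values at other `h` are never used. -/
def PolyBddDist {d : ℕ} {V : Type*} [NormedAddCommGroup V] [NormedSpace ℂ V]
    (u : ℝ → 𝓢'(Conf d, V)) : Prop :=
  ∃ p : Seminorm ℂ 𝓢(Conf d, ℂ), Continuous p ∧ ∃ N : ℝ, 0 < N ∧
    ∀ h : ℝ, 0 < h → h ≤ 1 → ∀ f : 𝓢(Conf d, ℂ), ‖u h f‖ ≤ h ^ (-N) * p f

/-- `(f_h) ∈ 𝓢_h(ℝ^d)`: polynomially bounded families of Schwartz functions. -/
def PolyBddSchwartz {d : ℕ} (f : ℝ → 𝓢(Conf d, ℂ)) : Prop :=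
  ∀ k n : ℕ, ∃ N : ℝ, 0 < N ∧
    (fun h : ℝ => SchwartzMap.seminorm ℂ k n (f h)) =O[𝓝[>] (0 : ℝ)] fun h : ℝ => h ^ (-N)

/-- `(f_h) ∈ C^∞_{0,h}(ℝ^d)`: polynomially bounded families of smooth functions supported in a
common compact set. -/
def PolyBddTest {d : ℕ} (f : ℝ → 𝓢(Conf d, ℂ)) : Prop :=
  (∃ K : Set (Conf d), IsCompact K ∧ ∀ h : ℝ, 0 < h → h ≤ 1 → tsupport (f h) ⊆ K) ∧
    PolyBddSchwartz f

/-- The family `(f_h)` is microlocally uniformly exponentially small in `U`. -/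
def MicroUnifExpSmall {d : ℕ} (f : ℝ → 𝓢(Conf d, ℂ)) (U : Set (Phase d)) : Prop :=
  ∃ δ : ℝ, 0 < δ ∧ ∀ N : ℕ, ∃ C : ℝ, 0 < C ∧ ∀ h : ℝ, 0 < h → h ≤ 1 → ∀ p ∈ U,
    ‖(((1 + ‖p.fst‖ ^ 2 + ‖p.snd‖ ^ 2) ^ N : ℝ) : ℂ) * fbi h (f h) p‖ ≤ C * Real.exp (-δ * h⁻¹)

/-- The family `(f_h)` is uniformly microsupported in `K`. -/
def UnifMicrosupportedIn {d : ℕ} (f : ℝ → 𝓢(Conf d, ℂ)) (K : Set (Phase d)) : Prop :=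
  ∀ ε : ℝ, 0 < ε → MicroUnifExpSmall f {p | ENNReal.ofReal ε < Metric.infEDist p K}

/-- The microsupport `μS(u_h)`: the complement of the set of points near which `T_h u_h` is
exponentially small, uniformly in the point and in `h ∈ (0, 1]`. -/
def microsupport {d : ℕ} {V : Type*} [NormedAddCommGroup V] [NormedSpace ℂ V]
    (u : ℝ → 𝓢'(Conf d, V)) : Set (Phase d) :=
  {p₀ | ∃ C δ : ℝ, 0 < C ∧ 0 < δ ∧ ∀ᶠ p in 𝓝 p₀, ∀ (h : ℝ) (hh : 0 < h), h ≤ 1 →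
    ‖fbiDist h hh (u h) p‖ < C * Real.exp (-δ * h⁻¹)}ᶜ

end Microlocal

end

/-! Everything rests on the duality `dist_apply_eq_integral`: `u f` is the integral over phase space
of `(T_h f)(a, b)` times `(T_h u)(a, -b)`. The sign flip in the second variable is the one between
`(x, ξ)` and `(x, -ξ)` in the theorem. The duality follows from the inversion formula
`fbi_inversion` (Fourier inversion of a Gaussian-windowed function, then a Gaussian integral), once
`u` is moved inside an integral of Schwartz functions by `clm_apply_eq_integral`.

If `(x, -ξ)` is outside the microsupport, split that integral. Near `(x, ξ)` the transform of `u` is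
exponentially small and that of `f` is bounded by a power of `h⁻¹` with rapid decay in phase space
(`fbi_decay`). Away from it the transform of `f` is exponentially small with rapid decay and that of
`u` is polynomially bounded in `h⁻¹` and the phase space variables. A power of `h⁻¹` costs only part
of the exponential rate.

Conversely, `T_h u` is itself a pairing of `u` with a kernel, so the kernels should serve as test
families. They lack compact support, but cutting them off changes them by exponentially small
Schwartz functions (`exists_kernelTail_le`), and the explicit transform of a kernel
(`norm_fbi_fbiKernel`) is a Gaussian centred at the reflected point. The hypothesis yields a rate
depending on the family, whereas the microsupport demands a bound uniform over a neighbourhood.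
Therefore one family is used whose centre, for each `h`, nearly maximises `‖T_h u_h‖` over a ball.
-/

noncomputable section

namespace Microlocal

variable {d : ℕ}

section

/-! ### The kernel as a function of all its variables -/

/-- The quadratic form `(x, ξ, y) ↦ -(x - y)² / 2 + i (x - y) · ξ`. -/
def fbiQuad (w : Conf d × Conf d × Conf d) : ℂ :=
  ((-(1 / 2) * ‖w.1 - w.2.2‖ ^ 2 : ℝ) : ℂ) + ((inner ℝ (w.1 - w.2.2) w.2.1 : ℝ) : ℂ) * Complex.I

/-- The FBI kernel as a function of `(x, ξ, y)` jointly. -/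
def jointKernel (h : ℝ) (w : Conf d × Conf d × Conf d) : ℂ :=
  Complex.exp ((h⁻¹ : ℝ) • fbiQuad w)

/-- All dependence on `h` sits in a scalar factor, so growth constants taken from `fbiQuad` are
uniform in `h`. -/
theorem fbiPhase_eq_smul_fbiQuad (h : ℝ) (p : Phase d) (y : Conf d) :
    fbiPhase h p y = (h⁻¹ : ℝ) • fbiQuad (p.fst, p.snd, y) := by
  simp only [fbiPhase, fbiQuad, Complex.real_smul]
  push_cast
  ring

@[simp]
theorem fbiKernel_apply {h : ℝ} (hh : 0 < h) (p : Phase d) (y : Conf d) :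
    fbiKernel h hh p y = Complex.exp (fbiPhase h p y) := rfl

theorem exp_fbiPhase_eq_jointKernel (h : ℝ) (p : Phase d) (y : Conf d) :
    Complex.exp (fbiPhase h p y) = jointKernel h (p.fst, p.snd, y) := by
  rw [fbiPhase_eq_smul_fbiQuad, jointKernel]

theorem fbiQuad_hasTemperateGrowth : (fbiQuad (d := d)).HasTemperateGrowth := by
  have h1 : (fun w : Conf d × Conf d × Conf d => w.1 - w.2.2).HasTemperateGrowth :=
    (ContinuousLinearMap.fst ℝ (Conf d) (Conf d × Conf d) -
      (ContinuousLinearMap.snd ℝ (Conf d) (Conf d)).comp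
        (ContinuousLinearMap.snd ℝ (Conf d) (Conf d × Conf d))).hasTemperateGrowth
  have h2 : (fun w : Conf d × Conf d × Conf d => w.2.1).HasTemperateGrowth :=
    ((ContinuousLinearMap.fst ℝ (Conf d) (Conf d)).comp
        (ContinuousLinearMap.snd ℝ (Conf d) (Conf d × Conf d))).hasTemperateGrowth
  have h3 : (fun w : Conf d × Conf d × Conf d => ‖w.1 - w.2.2‖ ^ 2).HasTemperateGrowth :=
    (Function.hasTemperateGrowth_norm_sq (H := Conf d)).comp h1
  have h4 : (fun w : Conf d × Conf d × Conf d =>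
      inner ℝ (w.1 - w.2.2) w.2.1).HasTemperateGrowth :=
    ContinuousLinearMap.bilinear_hasTemperateGrowth (innerSL ℝ (E := Conf d)) h1 h2
  exact (Function.Complex.hasTemperateGrowth_ofReal.comp
      ((Function.HasTemperateGrowth.const (-(1 / 2))).mul h3)).add
    ((Function.Complex.hasTemperateGrowth_ofReal.comp h4).mul
      (Function.HasTemperateGrowth.const Complex.I))

theorem contDiff_jointKernel (h : ℝ) : ContDiff ℝ ∞ (jointKernel (d := d) h) :=
  Complex.contDiff_exp.comp (fbiQuad_hasTemperateGrowth.1.const_smul h⁻¹)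

theorem norm_jointKernel (h : ℝ) (w : Conf d × Conf d × Conf d) :
    ‖jointKernel h w‖ = Real.exp (-(1 / (2 * h)) * ‖w.1 - w.2.2‖ ^ 2) := by
  rw [jointKernel, Complex.norm_exp, fbiQuad, Complex.smul_re]
  simp only [Complex.add_re, Complex.ofReal_re, Complex.re_ofReal_mul, Complex.I_re, mul_zero,
      add_zero, smul_eq_mul]
  congr 1
  ring

/-- Faà di Bruno: derivatives of `exp` are no larger than `exp`, and each derivative of the exponent
costs at most one factor `h⁻¹`. Joint derivatives are kept because those in `y` give Schwartz bounds
and those in the phase space point give continuity. -/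
theorem norm_iteratedFDeriv_jointKernel_le (n : ℕ) :
    ∃ (C : ℝ) (M : ℕ), 0 ≤ C ∧ ∀ h : ℝ, 0 < h → h ≤ 1 → ∀ w : Conf d × Conf d × Conf d,
      ‖iteratedFDeriv ℝ n (jointKernel h) w‖ ≤
        C * h⁻¹ ^ n * (1 + ‖w‖) ^ M * Real.exp (-(1 / (2 * h)) * ‖w.1 - w.2.2‖ ^ 2) := by
  obtain ⟨l, C, hC, hgrowth⟩ :=
    (fbiQuad_hasTemperateGrowth (d := d)).norm_iteratedFDeriv_le_uniform n
  refine ⟨n.factorial * (C + 1) ^ n, l * n, by positivity, fun h hh hh1 w => ?_⟩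
  have hinv : 1 ≤ h⁻¹ := (one_le_inv₀ hh).2 hh1
  -- The composition estimate wants an `i`-th power on the right. Replacing `C` by `C + 1` makes the
  -- base at least one, so a first power suffices.
  have hD : ∀ i, 1 ≤ i → i ≤ n → ‖iteratedFDeriv ℝ i ((h⁻¹ : ℝ) • fbiQuad) w‖ ≤
      (h⁻¹ * ((C + 1) * (1 + ‖w‖) ^ l)) ^ i := by
    intro i hi hin
    have h1 : (1 : ℝ) ≤ (C + 1) * (1 + ‖w‖) ^ l :=
      one_le_mul_of_one_le_of_one_le (by linarith)
        (one_le_pow₀ (by linarith [norm_nonneg w]))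
    have h2 : iteratedFDeriv ℝ i ((h⁻¹ : ℝ) • fbiQuad) w =
        (h⁻¹ : ℝ) • iteratedFDeriv ℝ i fbiQuad w :=
      iteratedFDeriv_const_smul_apply
        ((fbiQuad_hasTemperateGrowth (d := d)).1.of_le (by exact_mod_cast le_top)).contDiffAt
    rw [h2, norm_smul, Real.norm_of_nonneg (by positivity)]
    calc _ ≤ h⁻¹ * (C * (1 + ‖w‖) ^ l) := by gcongr; exact hgrowth i hin w
      _ ≤ h⁻¹ * ((C + 1) * (1 + ‖w‖) ^ l) := by gcongr; linarith
      _ ≤ _ := le_self_pow₀ (one_le_mul_of_one_le_of_one_le hinv h1) (by omega)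
  have hmain := norm_iteratedFDeriv_comp_le (𝕜 := ℝ) (N := ∞) (g := Complex.exp)
    (f := (h⁻¹ : ℝ) • fbiQuad) (n := n)
    (Complex.contDiff_exp) (fbiQuad_hasTemperateGrowth.1.const_smul h⁻¹)
    (by exact_mod_cast le_top) w
    (C := ‖jointKernel h w‖) (fun i _ => norm_iteratedFDeriv_cexp_le i _) hD
  refine hmain.trans_eq ?_
  rw [norm_jointKernel, mul_pow, mul_pow, ← pow_mul]
  ring

theorem iteratedFDeriv_jointKernel_slice (h : ℝ) (n : ℕ) (a b y : Conf d) :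
    iteratedFDeriv ℝ n (fun y => jointKernel h (a, b, y)) y =
      (iteratedFDeriv ℝ n (jointKernel h) (a, b, y)).compContinuousLinearMap fun _ =>
        (ContinuousLinearMap.inr ℝ (Conf d) (Conf d × Conf d)).comp
          (ContinuousLinearMap.inr ℝ (Conf d) (Conf d)) := by
  set L : Conf d →L[ℝ] Conf d × Conf d × Conf d :=
    (ContinuousLinearMap.inr ℝ (Conf d) (Conf d × Conf d)).comp
          (ContinuousLinearMap.inr ℝ (Conf d) (Conf d)) with hL
  have h1 : (fun y => jointKernel h (a, b, y)) =
      (fun z => jointKernel h (z + (a, b, 0))) ∘ L := by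
    funext z
    simp [hL]
  have h2 : ContDiff ℝ ∞ fun z => jointKernel h (z + (a, b, 0)) :=
    (contDiff_jointKernel h).comp (contDiff_id.add contDiff_const)
  rw [h1, L.iteratedFDeriv_comp_right h2 y (by exact_mod_cast le_top),
    iteratedFDeriv_comp_add_right]
  simp [hL]

theorem norm_compContinuousLinearMap_inr_inr_le {n : ℕ}
    (g : (Conf d × Conf d × Conf d) [×n]→L[ℝ] ℂ) :
    ‖g.compContinuousLinearMap fun _ =>
        (ContinuousLinearMap.inr ℝ (Conf d) (Conf d × Conf d)).comp
          (ContinuousLinearMap.inr ℝ (Conf d) (Conf d))‖ ≤ ‖g‖ := by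
  have hL : ‖(ContinuousLinearMap.inr ℝ (Conf d) (Conf d × Conf d)).comp
          (ContinuousLinearMap.inr ℝ (Conf d) (Conf d))‖ ≤ 1 := by
    refine ContinuousLinearMap.opNorm_le_bound _ zero_le_one fun x => ?_
    simp
  refine (g.norm_compContinuousLinearMap_le _).trans ?_
  refine mul_le_of_le_one_right (norm_nonneg _) ?_
  rw [Finset.prod_const]
  exact pow_le_one₀ (norm_nonneg _) hL

/-- Separates growth in the phase space point, which stays in the constants, from growth in `a - y`,
which the Gaussian absorbs. -/
theorem one_add_norm_le_mul (a b y : Conf d) :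
    1 + ‖(a, b, y)‖ ≤ (1 + ‖a‖ + ‖b‖) * (1 + ‖a - y‖) := by
  have hy : ‖y‖ ≤ ‖a‖ + ‖a - y‖ := by
    simpa using norm_sub_le a (a - y)
  have := mul_nonneg (norm_nonneg a) (norm_nonneg (a - y))
  have := mul_nonneg (norm_nonneg b) (norm_nonneg (a - y))
  have h1 : ‖(a, b, y)‖ ≤ ‖a‖ + ‖b‖ + ‖a - y‖ := by
    simp only [Prod.norm_def]
    refine max_le ?_ (max_le ?_ ?_) <;>
    linarith [norm_nonneg a, norm_nonneg b, norm_nonneg (a - y)]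
  nlinarith

/-- Pointwise bound for the derivatives of a product of the FBI kernel with a smooth function. -/
theorem norm_iteratedFDeriv_exp_fbiPhase_mul_le (n : ℕ) :
    ∃ (C : ℝ) (M : ℕ), 0 ≤ C ∧ ∀ h : ℝ, 0 < h → h ≤ 1 → ∀ (p : Phase d) (y : Conf d)
      (f : Conf d → ℂ) (A : ℝ), ContDiff ℝ ∞ f → (∀ i ≤ n, ‖iteratedFDeriv ℝ i f y‖ ≤ A) →
      ‖iteratedFDeriv ℝ n (fun y => Complex.exp (fbiPhase h p y) * f y) y‖ ≤
        C * A * h⁻¹ ^ n * (1 + ‖p.fst‖ + ‖p.snd‖) ^ M * (1 + ‖p.fst - y‖) ^ M *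
          Real.exp (-(1 / (2 * h)) * ‖p.fst - y‖ ^ 2) := by
  choose C M hC hCM using norm_iteratedFDeriv_jointKernel_le (d := d)
  set M' := (Finset.range (n + 1)).sup M with hM'
  refine ⟨∑ i ∈ Finset.range (n + 1), (n.choose i : ℝ) * C i, M',
    Finset.sum_nonneg fun i _ => mul_nonneg (by positivity) (hC i),
    fun h hh hh1 p y f A hf hA => ?_⟩
  have hinv : 1 ≤ h⁻¹ := (one_le_inv₀ hh).2 hh1
  have hA0 : 0 ≤ A := (norm_nonneg _).trans (hA 0 (by omega))
  have hk : (fun y => Complex.exp (fbiPhase h p y)) = fun y => jointKernel h (p.fst, p.snd, y) := by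
    funext y
    exact exp_fbiPhase_eq_jointKernel h p y
  refine (norm_iteratedFDeriv_mul_le (N := ∞)
    (Complex.contDiff_exp.comp (fbiPhase_hasTemperateGrowth h p).1) hf y
    (by exact_mod_cast le_top)).trans ?_
  simp only [Finset.sum_mul]
  refine Finset.sum_le_sum fun i hi => ?_
  have hin : i ≤ n := by simpa [Nat.lt_succ_iff] using hi
  have h1 : ‖iteratedFDeriv ℝ i (fun y => Complex.exp (fbiPhase h p y)) y‖ ≤
      C i * h⁻¹ ^ n * ((1 + ‖p.fst‖ + ‖p.snd‖) * (1 + ‖p.fst - y‖)) ^ M' *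
        Real.exp (-(1 / (2 * h)) * ‖p.fst - y‖ ^ 2) := by
    rw [hk, iteratedFDeriv_jointKernel_slice]
    refine (norm_compContinuousLinearMap_inr_inr_le _).trans ?_
    refine (hCM i h hh hh1 _).trans ?_
    have := hC i
    have h2 : (1 + ‖(p.fst, p.snd, y)‖) ^ M i ≤
        ((1 + ‖p.fst‖ + ‖p.snd‖) * (1 + ‖p.fst - y‖)) ^ M' :=
      (pow_le_pow_left₀ (by positivity) (one_add_norm_le_mul _ _ _) _).trans
        (pow_le_pow_right₀ (one_le_mul_of_one_le_of_one_le
          (by linarith [norm_nonneg p.fst, norm_nonneg p.snd])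
          (by linarith [norm_nonneg (p.fst - y)])) (Finset.le_sup hi))
    have h3 : h⁻¹ ^ i ≤ h⁻¹ ^ n := pow_le_pow_right₀ hinv hin
    gcongr
  have h4 := hA (n - i) (by omega)
  have := hC i
  calc _ ≤ (n.choose i : ℝ) * (C i * h⁻¹ ^ n *
        ((1 + ‖p.fst‖ + ‖p.snd‖) * (1 + ‖p.fst - y‖)) ^ M' *
        Real.exp (-(1 / (2 * h)) * ‖p.fst - y‖ ^ 2)) * A := by
        gcongr
        exact h1
    _ = _ := by rw [mul_pow]; ring

/-! ### Seminorm bounds -/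

/-- The `M`-th of an increasing family of seminorms defining the topology of `𝓢`. -/
def supSeminorm (d M : ℕ) : Seminorm ℂ 𝓢(Conf d, ℂ) :=
  (Finset.Iic (M, M)).sup (schwartzSeminormFamily ℂ (Conf d) ℂ)

theorem supSeminorm_mono {M M' : ℕ} (h : M ≤ M') : supSeminorm d M ≤ supSeminorm d M' :=
  Finset.sup_mono (Finset.Iic_subset_Iic.2 ⟨h, h⟩)

theorem continuous_supSeminorm (M : ℕ) : Continuous (supSeminorm d M) :=
  Finset.sup_induction (p := fun q : Seminorm ℂ 𝓢(Conf d, ℂ) => Continuous q)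
    continuous_const (fun _ h₁ _ h₂ => h₁.sup h₂)
    fun i _ => (schwartz_withSeminorms ℂ (Conf d) ℂ).continuous_seminorm i

theorem one_add_pow_mul_norm_iteratedFDeriv_le {k n M : ℕ} (hk : k ≤ M) (hn : n ≤ M)
    (f : 𝓢(Conf d, ℂ)) (y : Conf d) :
    (1 + ‖y‖) ^ k * ‖iteratedFDeriv ℝ n f y‖ ≤ 2 ^ M * supSeminorm d M f :=
  SchwartzMap.one_add_le_sup_seminorm_apply (𝕜 := ℂ) (m := (M, M)) hk hn f y

theorem exists_le_supSeminorm (q : Seminorm ℂ 𝓢(Conf d, ℂ)) (hq : Continuous q) :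
    ∃ (C : ℝ) (M : ℕ), 0 < C ∧ ∀ f, q f ≤ C * supSeminorm d M f := by
  obtain ⟨s, C, hC, hle⟩ :=
    Seminorm.bound_of_continuous (schwartz_withSeminorms ℂ (Conf d) ℂ) q hq
  refine ⟨C, s.sup fun i => max i.1 i.2, by positivity, fun f => (hle f).trans ?_⟩
  rw [smul_apply, NNReal.smul_def, smul_eq_mul]
  gcongr
  refine Seminorm.le_def.1 (Finset.sup_mono fun i hi => ?_) f
  have := Finset.le_sup (f := fun i : ℕ × ℕ => max i.1 i.2) hi
  exact Finset.mem_Iic.2 ⟨(le_max_left _ _).trans this, (le_max_right _ _).trans this⟩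

/-- Bounds for each Schwartz seminorm, monotone in a parameter, give a bound for every continuous
seminorm. -/
theorem exists_seminorm_bound {β : Type*} (r : β → 𝓢(Conf d, ℂ)) (B : ℕ → β → ℝ)
    (hB0 : ∀ M b, 0 ≤ B M b) (hB : ∀ b, Monotone fun M => B M b)
    (H : ∀ k n, ∃ (C : ℝ) (M : ℕ), 0 ≤ C ∧ ∀ b, SchwartzMap.seminorm ℂ k n (r b) ≤ C * B M b)
    (q : Seminorm ℂ 𝓢(Conf d, ℂ)) (hq : Continuous q) :
    ∃ (C : ℝ) (M : ℕ), 0 < C ∧ ∀ b, q (r b) ≤ C * B M b := by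
  obtain ⟨C₀, K, hC₀, hK⟩ := exists_le_supSeminorm q hq
  choose C M hC hCM using H
  refine ⟨C₀ * (∑ i ∈ Finset.Iic (K, K), C i.1 i.2 + 1),
    (Finset.Iic (K, K)).sup fun i => M i.1 i.2, ?_, fun b => ?_⟩
  · have : 0 ≤ ∑ i ∈ Finset.Iic (K, K), C i.1 i.2 := Finset.sum_nonneg fun i _ => hC _ _
    positivity
  have hs : 0 ≤ ∑ i ∈ Finset.Iic (K, K), C i.1 i.2 := Finset.sum_nonneg fun i _ => hC _ _
  refine (hK _).trans ?_
  rw [mul_assoc]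
  refine mul_le_mul_of_nonneg_left ?_ hC₀.le
  refine Seminorm.finset_sup_apply_le (mul_nonneg (by positivity) (hB0 _ _)) fun i hi => ?_
  refine (hCM i.1 i.2 b).trans ?_
  have h1 : C i.1 i.2 ≤ ∑ i ∈ Finset.Iic (K, K), C i.1 i.2 + 1 := by
    have := Finset.single_le_sum (f := fun i : ℕ × ℕ => C i.1 i.2) (fun i _ => hC _ _) hi
    linarith
  exact mul_le_mul h1 (hB b (Finset.le_sup (f := fun i : ℕ × ℕ => M i.1 i.2) hi)) (hB0 _ _)
    (by positivity)

/-- Schwartz bounds for the FBI kernel multiplied by a function with bounded derivatives that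
vanishes in a ball around the centre of the kernel. -/
theorem seminorm_cutoff_fbiKernel_le (ψ : Conf d → ℂ) (hψ : ContDiff ℝ ∞ ψ)
    (hψb : ∀ n, ∃ A : ℝ, ∀ y, ‖iteratedFDeriv ℝ n ψ y‖ ≤ A) (k n : ℕ) :
    ∃ (C : ℝ) (M : ℕ), 0 ≤ C ∧ ∀ h : ℝ, 0 < h → h ≤ 1 → ∀ (p : Phase d) (ρ : ℝ), 0 ≤ ρ →
      (∀ y ∈ Metric.ball p.fst ρ, ψ y = 0) → ∀ g : 𝓢(Conf d, ℂ),
      (∀ y, g y = Complex.exp (fbiPhase h p y) * ψ y) →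
      SchwartzMap.seminorm ℂ k n g ≤
        C * (h⁻¹ * (1 + ‖p.fst‖ + ‖p.snd‖)) ^ M * Real.exp (-(ρ ^ 2 / 4) * h⁻¹) := by
  choose A hA using hψb
  obtain ⟨C, M, hC, hCM⟩ := norm_iteratedFDeriv_exp_fbiPhase_mul_le (d := d) n
  obtain ⟨D, hD⟩ := pow_mul_gauss_bounded (1 / 4) (by norm_num) 0 le_rfl (M + k)
  have hA0 : ∀ i, 0 ≤ A i := fun i => (norm_nonneg _).trans (hA i 0)
  set A' := ∑ i ∈ Finset.range (n + 1), A i with hA'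
  have hA'0 : 0 ≤ A' := Finset.sum_nonneg fun i _ => hA0 i
  have hAi : ∀ i ≤ n, A i ≤ A' := fun i hi =>
    Finset.single_le_sum (f := A) (fun i _ => hA0 i) (Finset.mem_range.2 (by omega))
  have hD0 : 0 ≤ D := le_trans (by positivity) (hD 0 le_rfl)
  refine ⟨C * A' * D, n + M + k, by positivity, fun h hh hh1 p ρ hρ hz g hg => ?_⟩
  have hinv : 1 ≤ h⁻¹ := (one_le_inv₀ hh).2 hh1
  have hX : 1 ≤ 1 + ‖p.fst‖ + ‖p.snd‖ := by linarith [norm_nonneg p.fst, norm_nonneg p.snd]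
  refine SchwartzMap.seminorm_le_bound ℂ k n g (by positivity) fun y => ?_
  have hgf : (g : Conf d → ℂ) = fun y => Complex.exp (fbiPhase h p y) * ψ y := funext hg
  by_cases hy : y ∈ Metric.ball p.fst ρ
  · have h0 : (g : Conf d → ℂ) =ᶠ[𝓝 y] fun _ => 0 := by
      filter_upwards [Metric.isOpen_ball.mem_nhds hy] with z hz'
      rw [hg, hz z hz', mul_zero]
    rw [(Filter.EventuallyEq.iteratedFDeriv ℝ h0 n).eq_of_nhds]
    have : iteratedFDeriv ℝ n (fun _ : Conf d => (0 : ℂ)) y = 0 := by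
      simp
    rw [this, norm_zero, mul_zero]
    positivity
  · have hρt : ρ ≤ ‖p.fst - y‖ := by
      rw [Metric.mem_ball, not_lt, dist_comm, dist_eq_norm] at hy
      exact hy
    set t := ‖p.fst - y‖ with ht
    have ht0 : 0 ≤ t := norm_nonneg _
    -- The Gaussian is shared out: half of the exponent, with `h⁻¹ ≥ 1`, absorbs the powers of `1 +
    -- t`, and the other half, with `t ≥ ρ`, gives the exponential smallness.
    have hexp : Real.exp (-(1 / (2 * h)) * t ^ 2) ≤
        Real.exp (-(1 / 4) * t ^ 2) * Real.exp (-(ρ ^ 2 / 4) * h⁻¹) := by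
      rw [← Real.exp_add]
      refine Real.exp_le_exp.2 ?_
      have e1 : ρ ^ 2 ≤ t ^ 2 := pow_le_pow_left₀ hρ hρt 2
      have e2 : t ^ 2 ≤ t ^ 2 * h⁻¹ := le_mul_of_one_le_right (by positivity) hinv
      have e3 : ρ ^ 2 * h⁻¹ ≤ t ^ 2 * h⁻¹ := by gcongr
      have e4 : -(1 / (2 * h)) * t ^ 2 = -(1 / 2) * (t ^ 2 * h⁻¹) := by field_simp
      rw [e4]
      linarith
    have hyk : ‖y‖ ^ k ≤ (1 + ‖p.fst‖ + ‖p.snd‖) ^ k * (1 + t) ^ k := by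
      rw [← mul_pow]
      refine pow_le_pow_left₀ (norm_nonneg _) (le_trans ?_ (one_add_norm_le_mul p.fst p.snd y)) k
      have : ‖y‖ ≤ ‖(p.fst, p.snd, y)‖ := (norm_snd_le (p.snd, y)).trans
        (norm_snd_le (p.fst, p.snd, y))
      linarith
    have hmain := hCM h hh hh1 p y ψ A' hψ (fun i hi => (hA i y).trans (hAi i hi))
    rw [hgf]
    have hDt := hD t ht0
    rw [add_zero, pow_add] at hDt
    calc _ ≤ ((1 + ‖p.fst‖ + ‖p.snd‖) ^ k * (1 + t) ^ k) *
          (C * A' * h⁻¹ ^ n * (1 + ‖p.fst‖ + ‖p.snd‖) ^ M * (1 + t) ^ M *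
          (Real.exp (-(1 / 4) * t ^ 2) * Real.exp (-(ρ ^ 2 / 4) * h⁻¹))) := by
          gcongr
          exact hmain.trans (by gcongr)
      _ = C * A' * ((1 + t) ^ M * (1 + t) ^ k * Real.exp (-(1 / 4) * t ^ 2)) *
          (h⁻¹ ^ n * (1 + ‖p.fst‖ + ‖p.snd‖) ^ (M + k)) * Real.exp (-(ρ ^ 2 / 4) * h⁻¹) := by
          rw [pow_add]; ring
      _ ≤ C * A' * D * (h⁻¹ * (1 + ‖p.fst‖ + ‖p.snd‖)) ^ (n + M + k) *
          Real.exp (-(ρ ^ 2 / 4) * h⁻¹) := by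
          rw [mul_pow]
          gcongr <;> first | assumption | omega

/-- Bound of the kernel multiplied by a cutoff with respect to any continuous seminorm. -/
theorem cutoff_fbiKernel_le (ψ : Conf d → ℂ) (hψ : ContDiff ℝ ∞ ψ)
    (hψb : ∀ n, ∃ A : ℝ, ∀ y, ‖iteratedFDeriv ℝ n ψ y‖ ≤ A)
    (q : Seminorm ℂ 𝓢(Conf d, ℂ)) (hq : Continuous q) :
    ∃ (C : ℝ) (M : ℕ), 0 < C ∧ ∀ h : ℝ, 0 < h → h ≤ 1 → ∀ (p : Phase d) (ρ : ℝ), 0 ≤ ρ →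
      (∀ y ∈ Metric.ball p.fst ρ, ψ y = 0) → ∀ g : 𝓢(Conf d, ℂ),
      (∀ y, g y = Complex.exp (fbiPhase h p y) * ψ y) →
      q g ≤ C * ((h⁻¹ * (1 + ‖p.fst‖ + ‖p.snd‖)) ^ M * Real.exp (-(ρ ^ 2 / 4) * h⁻¹)) := by
  -- All parameters and their constraints form one index type, so that the constants of
  -- `exists_seminorm_bound` are uniform in them.
  let β := {b : ℝ × Phase d × ℝ × 𝓢(Conf d, ℂ) // 0 < b.1 ∧ b.1 ≤ 1 ∧ 0 ≤ b.2.2.1 ∧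
    (∀ y ∈ Metric.ball b.2.1.fst b.2.2.1, ψ y = 0) ∧
    ∀ y, b.2.2.2 y = Complex.exp (fbiPhase b.1 b.2.1 y) * ψ y}
  obtain ⟨C, M, hC, H⟩ := exists_seminorm_bound (fun b : β => b.1.2.2.2)
    (fun M b => (b.1.1⁻¹ * (1 + ‖b.1.2.1.fst‖ + ‖b.1.2.1.snd‖)) ^ M *
      Real.exp (-(b.1.2.2.1 ^ 2 / 4) * b.1.1⁻¹))
    (fun M b => by have := b.2.1; positivity)
    (fun b M M' hMM => by
      have h1 : 1 ≤ b.1.1⁻¹ := (one_le_inv₀ b.2.1).2 b.2.2.1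
      refine mul_le_mul_of_nonneg_right (pow_le_pow_right₀ ?_ hMM) (Real.exp_nonneg _)
      exact one_le_mul_of_one_le_of_one_le h1
        (by linarith [norm_nonneg b.1.2.1.fst, norm_nonneg b.1.2.1.snd]))
    (fun k n => by
      obtain ⟨C, M, hC, H⟩ := seminorm_cutoff_fbiKernel_le ψ hψ hψb k n
      refine ⟨C, M, hC, fun b => ?_⟩
      rw [← mul_assoc]
      exact H b.1.1 b.2.1 b.2.2.1 b.1.2.1 _ b.2.2.2.1 b.2.2.2.2.1 _ b.2.2.2.2.2) q hq
  exact ⟨C, M, hC, fun h hh hh1 p ρ hρ hz g hg => H ⟨(h, p, ρ, g), hh, hh1, hρ, hz, hg⟩⟩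

theorem fbiKernel_le (q : Seminorm ℂ 𝓢(Conf d, ℂ)) (hq : Continuous q) :
    ∃ (C : ℝ) (M : ℕ), 0 < C ∧ ∀ (h : ℝ) (hh : 0 < h), h ≤ 1 → ∀ p : Phase d,
      q (fbiKernel h hh p) ≤ C * (h⁻¹ * (1 + ‖p.fst‖ + ‖p.snd‖)) ^ M := by
  obtain ⟨C, M, hC, H⟩ := cutoff_fbiKernel_le (fun _ : Conf d => (1 : ℂ)) contDiff_const
    (fun n => by
      refine ⟨1, fun y => ?_⟩
      rcases n with _ | n
      · simp
      · simp [iteratedFDeriv_const_of_ne (Nat.succ_ne_zero n)]) q hq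
  refine ⟨C, M, hC, fun h hh hh1 p => ?_⟩
  simpa using H h hh hh1 p 0 le_rfl (by simp) (fbiKernel h hh p) (fun y => by simp)

end

/-! ### Continuity of the kernel in the phase space point -/

section

/-- The FBI kernel depends continuously on the phase space point, in the Schwartz topology. -/
theorem continuous_fbiKernel {h : ℝ} (hh : 0 < h) (hh1 : h ≤ 1) :
    Continuous fun z : Conf d × Conf d => fbiKernel h hh (pt z.1 z.2) := by
  refine continuous_iff_continuousAt.2 fun z₀ => ?_
  rw [ContinuousAt, (schwartz_withSeminorms ℂ (Conf d) ℂ).tendsto_nhds]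
  rintro ⟨k, n⟩ ε hε
  obtain ⟨C, M, hC, hCM⟩ := norm_iteratedFDeriv_jointKernel_le (d := d) (n + 1)
  set R := ‖z₀‖ + 1 with hR
  obtain ⟨D, hD⟩ := pow_mul_gauss_bounded (1 / (4 * h)) (by positivity) R (by positivity)
    (M + k)
  have hD0 : 0 ≤ D := le_trans (by positivity) (hD 0 le_rfl)
  set B := C * h⁻¹ ^ (n + 1) * (D * Real.exp (R ^ 2 / (2 * h))) with hB
  have hB0 : 0 ≤ B := by positivity
  -- A local Lipschitz bound in each Schwartz seminorm, from the mean value inequality for the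
  -- `n`-th joint derivative with `y` frozen.
  have key : ∀ z : Conf d × Conf d, ‖z - z₀‖ ≤ 1 →
      SchwartzMap.seminorm ℂ k n (fbiKernel h hh (pt z.1 z.2) - fbiKernel h hh (pt z₀.1 z₀.2)) ≤
        B * ‖z - z₀‖ := by
    intro z hz
    refine SchwartzMap.seminorm_le_bound ℂ k n _ (by positivity) fun y => ?_
    have hcoe : ∀ z : Conf d × Conf d, (fbiKernel h hh (pt z.1 z.2) : Conf d → ℂ) =
        fun y => jointKernel h (z.1, z.2, y) := fun z => funext fun y =>
      exp_fbiPhase_eq_jointKernel h (pt z.1 z.2) y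
    have hsub : iteratedFDeriv ℝ n
        (fbiKernel h hh (pt z.1 z.2) - fbiKernel h hh (pt z₀.1 z₀.2) : 𝓢(Conf d, ℂ)) y =
        iteratedFDeriv ℝ n (fbiKernel h hh (pt z.1 z.2)) y -
          iteratedFDeriv ℝ n (fbiKernel h hh (pt z₀.1 z₀.2)) y :=
      iteratedFDeriv_sub_apply ((fbiKernel h hh (pt z.1 z.2)).contDiffAt n)
        ((fbiKernel h hh (pt z₀.1 z₀.2)).contDiffAt n)
    rw [hsub, hcoe, hcoe, iteratedFDeriv_jointKernel_slice, iteratedFDeriv_jointKernel_slice]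
    have hlin : ∀ (f g : (Conf d × Conf d × Conf d) [×n]→L[ℝ] ℂ)
        (L : Conf d →L[ℝ] Conf d × Conf d × Conf d),
        f.compContinuousLinearMap (fun _ => L) - g.compContinuousLinearMap (fun _ => L) =
          (f - g).compContinuousLinearMap fun _ => L := fun f g L => rfl
    rw [hlin]
    set F : Conf d × Conf d → (Conf d × Conf d × Conf d) [×n]→L[ℝ] ℂ :=
      fun z => iteratedFDeriv ℝ n (jointKernel h) (z.1, z.2, y) with hF
    set S : Set (Conf d × Conf d × Conf d) :=
      Metric.closedBall z₀.1 1 ×ˢ Metric.closedBall z₀.2 1 ×ˢ {y} with hS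
    have hSconv : Convex ℝ S :=
      (convex_closedBall _ _).prod ((convex_closedBall _ _).prod (convex_singleton y))
    have hz₀S : (z₀.1, z₀.2, y) ∈ S := by simp [hS]
    have hz1 : ‖z.1 - z₀.1‖ ≤ 1 := (norm_fst_le (z - z₀)).trans hz
    have hz2 : ‖z.2 - z₀.2‖ ≤ 1 := (norm_snd_le (z - z₀)).trans hz
    have hzS : (z.1, z.2, y) ∈ S := by
      simp [hS, dist_eq_norm, hz1, hz2]
    have hbound : ∀ w ∈ S, ‖fderiv ℝ (iteratedFDeriv ℝ n (jointKernel h)) w‖ ≤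
        C * h⁻¹ ^ (n + 1) * (1 + R + ‖y‖) ^ M *
          (Real.exp (-(1 / (4 * h)) * ‖y‖ ^ 2) * Real.exp (R ^ 2 / (2 * h))) := by
      rintro ⟨a, b, y'⟩ ⟨ha, hb, rfl⟩
      rw [norm_fderiv_iteratedFDeriv]
      refine (hCM h hh hh1 _).trans ?_
      have ha' : ‖a‖ ≤ R := by
        have h1 : ‖a - z₀.1‖ ≤ 1 := by simpa [dist_eq_norm] using ha
        have h2 := norm_fst_le z₀
        have h3 := norm_le_norm_add_norm_sub' a z₀.1
        linarith
      have hb' : ‖b‖ ≤ R := by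
        have h1 : ‖b - z₀.2‖ ≤ 1 := by simpa [dist_eq_norm] using hb
        have h2 := norm_snd_le z₀
        have h3 := norm_le_norm_add_norm_sub' b z₀.2
        linarith
      have hw : ‖(a, b, y')‖ ≤ R + ‖y'‖ := by
        simp only [Prod.norm_def]
        refine max_le ?_ (max_le ?_ ?_) <;> linarith [norm_nonneg y', norm_nonneg a]
      rw [← Real.exp_add]
      -- Since `a` stays in a ball of radius `R`, the Gaussian in `a - y'` is dominated by one in
      -- `y'` of half the rate. This makes the bound uniform over `S` and able to absorb powers of
      -- `‖y'‖`.
      have hexp : -(1 / (2 * h)) * ‖a - y'‖ ^ 2 ≤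
          -(1 / (4 * h)) * ‖y'‖ ^ 2 + R ^ 2 / (2 * h) := by
        have h1 : ‖y'‖ ≤ ‖a‖ + ‖a - y'‖ := by simpa using norm_sub_le a (a - y')
        have h2 : ‖y'‖ ^ 2 ≤ 2 * R ^ 2 + 2 * ‖a - y'‖ ^ 2 := by
          have h3 : ‖y'‖ ^ 2 ≤ (R + ‖a - y'‖) ^ 2 :=
            pow_le_pow_left₀ (norm_nonneg _) (by linarith) 2
          nlinarith [sq_nonneg (R - ‖a - y'‖)]
        have h4 : 0 ≤ (1 / (4 * h)) * (2 * R ^ 2 + 2 * ‖a - y'‖ ^ 2 - ‖y'‖ ^ 2) :=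
          mul_nonneg (by positivity) (by linarith)
        have h5 : (1 / (4 * h)) * (2 * R ^ 2 + 2 * ‖a - y'‖ ^ 2 - ‖y'‖ ^ 2) =
            -(1 / (4 * h)) * ‖y'‖ ^ 2 + R ^ 2 / (2 * h) - -(1 / (2 * h)) * ‖a - y'‖ ^ 2 := by
          field_simp
          ring
        linarith
      gcongr ?_ * ?_ ^ M * ?_
      · linarith
      · exact Real.exp_le_exp.2 hexp
    have hmv := Convex.norm_image_sub_le_of_norm_fderiv_le (𝕜 := ℝ) (fun w _ =>
      ((contDiff_jointKernel h).differentiable_iteratedFDeriv (m := n)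
        (by exact_mod_cast ENat.natCast_lt_top n)) w) hbound hSconv hz₀S hzS
    have hnorm : ‖(z.1, z.2, y) - (z₀.1, z₀.2, y)‖ = ‖z - z₀‖ := by
      simp [Prod.norm_def]
    rw [hnorm] at hmv
    calc _ ≤ ‖y‖ ^ k * ‖F z - F z₀‖ := by
          gcongr
          exact norm_compContinuousLinearMap_inr_inr_le _
      _ ≤ (1 + R + ‖y‖) ^ k * (C * h⁻¹ ^ (n + 1) * (1 + R + ‖y‖) ^ M *
          (Real.exp (-(1 / (4 * h)) * ‖y‖ ^ 2) * Real.exp (R ^ 2 / (2 * h))) * ‖z - z₀‖) := by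
          have : ‖y‖ ≤ 1 + R + ‖y‖ := by
            have : 0 ≤ R := by positivity
            linarith
          gcongr
      _ = C * h⁻¹ ^ (n + 1) * ((1 + R + ‖y‖) ^ (M + k) * Real.exp (-(1 / (4 * h)) * ‖y‖ ^ 2) *
          Real.exp (R ^ 2 / (2 * h))) * ‖z - z₀‖ := by rw [pow_add]; ring
      _ ≤ _ := by
          rw [hB]
          gcongr
          exact hD _ (norm_nonneg y)
  have hlim : Filter.Tendsto (fun z : Conf d × Conf d => B * ‖z - z₀‖) (𝓝 z₀) (𝓝 0) := by
    have : Continuous fun z : Conf d × Conf d => B * ‖z - z₀‖ := by fun_prop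
    simpa using this.tendsto z₀
  filter_upwards [hlim.eventually_lt_const hε, Metric.closedBall_mem_nhds z₀ one_pos] with z hz1 hz2
  exact (key z (by simpa [dist_eq_norm] using hz2)).trans_lt hz1

end

section

open scoped FourierTransform

/-! ### The FBI transform as a windowed Fourier transform -/

@[simp] theorem pt_fst (x ξ : Conf d) : (pt x ξ).fst = x := rfl

@[simp] theorem pt_snd (x ξ : Conf d) : (pt x ξ).snd = ξ := rfl

theorem pt_fst_snd (p : Phase d) : pt p.fst p.snd = p := rfl

/-- Pointwise multiplication by a fixed Schwartz function, as an operator on `𝓢`. -/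
def mulSchwartz (f : 𝓢(Conf d, ℂ)) : 𝓢(Conf d, ℂ) →L[ℂ] 𝓢(Conf d, ℂ) :=
  SchwartzMap.pairing (ContinuousLinearMap.mul ℂ ℂ) f

@[simp]
theorem mulSchwartz_apply (f g : 𝓢(Conf d, ℂ)) (y : Conf d) : mulSchwartz f g y = f y * g y := by
  simp [mulSchwartz]

/-- The function `f` localised by the Gaussian window of width `√h` around `a`. -/
def window {h : ℝ} (hh : 0 < h) (a : Conf d) (f : 𝓢(Conf d, ℂ)) : 𝓢(Conf d, ℂ) :=
  mulSchwartz (fbiKernel h hh (pt a 0)) f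

theorem window_apply {h : ℝ} (hh : 0 < h) (a : Conf d) (f : 𝓢(Conf d, ℂ)) (y : Conf d) :
    window hh a f y = ((Real.exp (-(1 / (2 * h)) * ‖a - y‖ ^ 2) : ℝ) : ℂ) * f y := by
  simp [window, fbiPhase]

theorem fbi_eq_fourier {h : ℝ} (hh : 0 < h) (f : 𝓢(Conf d, ℂ)) (a b : Conf d) :
    fbi h f (pt a b) = fbiConst d h * (Complex.exp (((1 / h * inner ℝ a b : ℝ) : ℂ) * Complex.I) *
      𝓕 (window hh a f : Conf d → ℂ) ((2 * Real.pi * h)⁻¹ • b)) := by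
  rw [fbi, Real.fourier_eq', ← MeasureTheory.integral_const_mul (Complex.exp _)]
  congr 2
  funext y
  rw [window_apply, smul_eq_mul, inner_smul_right, fbiPhase, Complex.ofReal_exp, pt_fst, pt_snd,
    Complex.exp_add]
  have h1 : Complex.exp (((1 / h * inner ℝ (a - y) b : ℝ) : ℂ) * Complex.I) =
      Complex.exp (((1 / h * inner ℝ a b : ℝ) : ℂ) * Complex.I) * Complex.exp
        (((-2 * Real.pi * ((2 * Real.pi * h)⁻¹ * inner ℝ y b) : ℝ) : ℂ) * Complex.I) := by
    rw [← Complex.exp_add, ← add_mul, ← Complex.ofReal_add]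
    congr 3
    rw [inner_sub_left]
    field_simp
    ring
  rw [h1]
  ring

theorem fbiConst_nonneg {h : ℝ} (hh : 0 < h) : 0 ≤ fbiConst d h := by
  unfold fbiConst
  positivity

theorem fbiConst_le {h : ℝ} (hh : 0 < h) (hh1 : h ≤ 1) : fbiConst d h ≤ h⁻¹ ^ d := by
  have h1 : (2 : ℝ) ^ (-(d : ℝ) / 2) ≤ 1 :=
    Real.rpow_le_one_of_one_le_of_nonpos (by norm_num)
      (div_nonpos_of_nonpos_of_nonneg (by simp) (by norm_num))
  have h2 : (Real.pi * h) ^ (-(3 * (d : ℝ)) / 4) ≤ h⁻¹ ^ d := by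
    calc _ ≤ h ^ (-(3 * (d : ℝ)) / 4) := by
          refine Real.rpow_le_rpow_of_nonpos hh ?_ ?_
          · nlinarith [Real.pi_gt_three]
          · exact div_nonpos_of_nonpos_of_nonneg (by simp) (by norm_num)
      _ ≤ h ^ (-(d : ℝ)) := by
          refine Real.rpow_le_rpow_of_exponent_ge hh hh1 ?_
          have : (0 : ℝ) ≤ d := by positivity
          linarith
      _ = _ := by rw [Real.rpow_neg hh.le, Real.rpow_natCast, inv_pow]
  calc _ ≤ 1 * h⁻¹ ^ d := mul_le_mul h1 h2 (by positivity) zero_le_one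
    _ = _ := one_mul _

/-- The identity behind the choice of `α_h`: in the inversion formula, `(2πh)^d` comes from
rescaling the Fourier variable and `(πh)^{d/2}` from the Gaussian integral over the position. -/
theorem fbiConst_sq_mul {h : ℝ} (hh : 0 < h) :
    fbiConst d h ^ 2 * (2 * Real.pi * h) ^ d * (Real.pi * h) ^ ((d : ℝ) / 2) = 1 := by
  have hp : 0 < Real.pi * h := by positivity
  have h1 : ((2 : ℝ) ^ (-(d : ℝ) / 2)) ^ 2 = 2 ^ (-(d : ℝ)) := by
    rw [← Real.rpow_natCast, ← Real.rpow_mul (by norm_num)]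
    congr 1
    push_cast
    ring
  have h2 : ((Real.pi * h) ^ (-(3 * (d : ℝ)) / 4)) ^ 2 = (Real.pi * h) ^ (-(3 * (d : ℝ)) / 2) := by
    rw [← Real.rpow_natCast, ← Real.rpow_mul hp.le]
    congr 1
    push_cast
    ring
  have h3 : (2 * Real.pi * h) ^ d = 2 ^ (d : ℝ) * (Real.pi * h) ^ (d : ℝ) := by
    rw [Real.rpow_natCast, Real.rpow_natCast, ← mul_pow, mul_assoc]
  rw [fbiConst, mul_pow, h1, h2, h3]
  calc _ = ((2 : ℝ) ^ (-(d : ℝ)) * 2 ^ (d : ℝ)) * ((Real.pi * h) ^ (-(3 * (d : ℝ)) / 2) *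
        (Real.pi * h) ^ (d : ℝ) * (Real.pi * h) ^ ((d : ℝ) / 2)) := by ring
    _ = 1 := by
        rw [← Real.rpow_add (by norm_num), ← Real.rpow_add hp, ← Real.rpow_add hp]
        have e1 : -(d : ℝ) + d = 0 := by ring
        have e2 : -(3 * (d : ℝ)) / 2 + d + d / 2 = 0 := by ring
        rw [e1, e2, Real.rpow_zero, Real.rpow_zero, mul_one]

/-! ### Rapid decay of the FBI transform of a Schwartz function -/

theorem one_add_norm_sq_le (a : Conf d) : 1 + ‖a‖ ^ 2 ≤ (1 + ‖a‖) ^ 2 := by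
  nlinarith [norm_nonneg a]

theorem one_add_norm_le_mul_sub (a y : Conf d) : 1 + ‖a‖ ≤ (1 + ‖y‖) * (1 + ‖a - y‖) := by
  have h1 := norm_le_norm_add_norm_sub' a y
  nlinarith [mul_nonneg (norm_nonneg y) (norm_nonneg (a - y))]

/-- The weight in `a` is split by `1 + ‖a‖ ≤ (1 + ‖y‖)(1 + ‖a - y‖)`: the decay of `f` pays for the
first factor and the Gaussian window for the second. -/
theorem seminorm_window_le (N k n : ℕ) :
    ∃ (C : ℝ) (M : ℕ), 0 ≤ C ∧ ∀ (h : ℝ) (hh : 0 < h), h ≤ 1 → ∀ (a : Conf d) (f : 𝓢(Conf d, ℂ)),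
      (1 + ‖a‖ ^ 2) ^ N * SchwartzMap.seminorm ℂ k n (window hh a f) ≤
        C * (h⁻¹ ^ M * supSeminorm d M f) := by
  obtain ⟨C, M, hC, hCM⟩ := norm_iteratedFDeriv_exp_fbiPhase_mul_le (d := d) n
  obtain ⟨D, hD⟩ := pow_mul_gauss_bounded (1 / 2) (by norm_num) 0 le_rfl (2 * M + 2 * N)
  have hD0 : 0 ≤ D := le_trans (by positivity) (hD 0 le_rfl)
  set K := k + M + 2 * N with hK
  refine ⟨C * 2 ^ (K + n) * D, K + n, by positivity, fun h hh hh1 a f => ?_⟩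
  have hinv : 1 ≤ h⁻¹ := (one_le_inv₀ hh).2 hh1
  have hw : 0 < (1 + ‖a‖ ^ 2) ^ N := by positivity
  have hs0 : 0 ≤ supSeminorm d (K + n) f := apply_nonneg _ _
  rw [← le_div_iff₀' hw]
  refine SchwartzMap.seminorm_le_bound ℂ k n _ (by positivity) fun y => ?_
  rw [le_div_iff₀' hw]
  have hwin : (window hh a f : Conf d → ℂ) =
      fun y => Complex.exp (fbiPhase h (pt a 0) y) * f y := by
    funext y
    simp [window]
  set A := 2 ^ (K + n) * supSeminorm d (K + n) f / (1 + ‖y‖) ^ K with hA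
  have hA0 : 0 ≤ A := by positivity
  have hmain := hCM h hh hh1 (pt a 0) y f A (f.smooth ⊤) fun i hi => by
    rw [hA, le_div_iff₀' (by positivity)]
    exact one_add_pow_mul_norm_iteratedFDeriv_le (by omega) (by omega) f y
  rw [pt_fst, pt_snd, norm_zero, add_zero] at hmain
  rw [hwin]
  set t := ‖a - y‖ with ht
  have ht0 : 0 ≤ t := norm_nonneg _
  have hexp : Real.exp (-(1 / (2 * h)) * t ^ 2) ≤ Real.exp (-(1 / 2) * t ^ 2) := by
    refine Real.exp_le_exp.2 ?_
    have e2 : t ^ 2 ≤ t ^ 2 * h⁻¹ := le_mul_of_one_le_right (by positivity) hinv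
    have e4 : -(1 / (2 * h)) * t ^ 2 = -(1 / 2) * (t ^ 2 * h⁻¹) := by field_simp
    rw [e4]
    linarith
  have hDt := hD t ht0
  rw [add_zero] at hDt
  have ha := one_add_norm_le_mul_sub a y
  have ha1 : (1 + ‖a‖ ^ 2) ^ N ≤ ((1 + ‖y‖) * (1 + t)) ^ (2 * N) := by
    rw [pow_mul]
    refine pow_le_pow_left₀ (by positivity) ((one_add_norm_sq_le a).trans ?_) N
    exact pow_le_pow_left₀ (by positivity) ha 2
  have ha2 : (1 + ‖a‖) ^ M ≤ ((1 + ‖y‖) * (1 + t)) ^ M := pow_le_pow_left₀ (by positivity) ha M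
  have hyk : ‖y‖ ^ k ≤ (1 + ‖y‖) ^ k := pow_le_pow_left₀ (norm_nonneg _) (by linarith) k
  have hAK : (1 + ‖y‖) ^ K * A = 2 ^ (K + n) * supSeminorm d (K + n) f := by
    rw [hA]
    field_simp
  calc _ ≤ ((1 + ‖y‖) * (1 + t)) ^ (2 * N) * ((1 + ‖y‖) ^ k * (C * A * h⁻¹ ^ n *
        ((1 + ‖y‖) * (1 + t)) ^ M * (1 + t) ^ M * Real.exp (-(1 / 2) * t ^ 2))) := by
        gcongr
        exact hmain.trans (by gcongr)
    _ = C * ((1 + ‖y‖) ^ K * A) * ((1 + t) ^ (2 * M + 2 * N) * Real.exp (-(1 / 2) * t ^ 2)) *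
        h⁻¹ ^ n := by
        rw [hK]
        simp only [mul_pow, pow_add, two_mul]
        ring
    _ ≤ C * ((1 + ‖y‖) ^ K * A) * D * h⁻¹ ^ (K + n) := by
        gcongr
        omega
    _ = _ := by rw [hAK]; ring

/-- The FBI transform of a Schwartz function decays rapidly, with constants that grow at most
polynomially in `h⁻¹`. -/
theorem fbi_decay (N : ℕ) :
    ∃ (C : ℝ) (M : ℕ), 0 < C ∧ ∀ h : ℝ, 0 < h → h ≤ 1 → ∀ (f : 𝓢(Conf d, ℂ)) (p : Phase d),
      (1 + ‖p.fst‖ ^ 2 + ‖p.snd‖ ^ 2) ^ N * ‖fbi h f p‖ ≤ C * (h⁻¹ ^ M * supSeminorm d M f) := by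
  let β := {b : ℝ × Conf d × 𝓢(Conf d, ℂ) // 0 < b.1 ∧ b.1 ≤ 1}
  obtain ⟨C, M, hC, H⟩ := exists_seminorm_bound
    (fun b : β => (((1 + ‖b.1.2.1‖ ^ 2) ^ N : ℝ) : ℂ) • window b.2.1 b.1.2.1 b.1.2.2)
    (fun M b => b.1.1⁻¹ ^ M * supSeminorm d M b.1.2.2)
    (fun M b => by
      have := b.2.1
      have : 0 ≤ supSeminorm d M b.1.2.2 := apply_nonneg _ _
      positivity)
    (fun b M M' hMM => by
      have h1 : 1 ≤ b.1.1⁻¹ := (one_le_inv₀ b.2.1).2 b.2.2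
      exact mul_le_mul (pow_le_pow_right₀ h1 hMM) (supSeminorm_mono hMM _) (apply_nonneg _ _)
        (by positivity))
    (fun k n => by
      obtain ⟨C, M, hC, H⟩ := seminorm_window_le (d := d) N k n
      refine ⟨C, M, hC, fun b => ?_⟩
      rw [map_smul_eq_mul, Complex.norm_real, Real.norm_of_nonneg (by positivity)]
      exact H b.1.1 b.2.1 b.2.2 b.1.2.1 b.1.2.2)
    -- Choosing a seminorm of the Fourier transform turns Schwartz bounds on the window into decay
    -- in the frequency variable.
    ((supSeminorm d (2 * N)).comp
      ((SchwartzMap.fourierTransformCLM ℂ (V := Conf d) (E := ℂ) :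
        𝓢(Conf d, ℂ) →L[ℂ] 𝓢(Conf d, ℂ)) : 𝓢(Conf d, ℂ) →ₗ[ℂ] 𝓢(Conf d, ℂ)))
    ((continuous_supSeminorm _).comp (SchwartzMap.fourierTransformCLM ℂ).continuous)
  refine ⟨7 ^ (2 * N) * 2 ^ (2 * N) * C, M + d, by positivity, fun h hh hh1 f p => ?_⟩
  have hinv : 1 ≤ h⁻¹ := (one_le_inv₀ hh).2 hh1
  have hb := H ⟨(h, p.fst, f), hh, hh1⟩
  simp only [Seminorm.comp_apply, ContinuousLinearMap.coe_coe, map_smul] at hb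
  rw [map_smul_eq_mul, Complex.norm_real, Real.norm_of_nonneg (by positivity),
    SchwartzMap.fourierTransformCLM_apply] at hb
  rw [← pt_fst_snd p, fbi_eq_fourier hh, pt_fst, pt_snd]
  set η := (2 * Real.pi * h)⁻¹ • p.snd with hη
  have hF : (1 + ‖η‖) ^ (2 * N) * ‖𝓕 (window hh p.fst f : Conf d → ℂ) η‖ ≤
      2 ^ (2 * N) * supSeminorm d (2 * N) (𝓕 (window hh p.fst f)) := by
    have := one_add_pow_mul_norm_iteratedFDeriv_le (d := d) (k := 2 * N) (n := 0) le_rfl (by omega)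
      (𝓕 (window hh p.fst f)) η
    rwa [norm_iteratedFDeriv_zero] at this
  -- The constant `7` exceeds `2π`, and `h ≤ 1`.
  have hsnd : ‖p.snd‖ ≤ 7 * ‖η‖ := by
    have h1 : p.snd = (2 * Real.pi * h) • η := by
      rw [hη, smul_smul, mul_inv_cancel₀ (by positivity), one_smul]
    rw [h1, norm_smul, Real.norm_of_nonneg (by positivity)]
    gcongr
    nlinarith [Real.pi_lt_d2, Real.pi_pos]
  have hw : (1 + ‖p.fst‖ ^ 2 + ‖p.snd‖ ^ 2) ^ N ≤
      (1 + ‖p.fst‖ ^ 2) ^ N * (7 ^ (2 * N) * (1 + ‖η‖) ^ (2 * N)) := by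
    rw [← mul_pow 7, pow_mul, ← mul_pow]
    refine pow_le_pow_left₀ (by positivity) ?_ N
    have h1 : ‖p.snd‖ ^ 2 ≤ (7 * ‖η‖) ^ 2 := pow_le_pow_left₀ (norm_nonneg _) hsnd 2
    have h2 : 1 + ‖p.snd‖ ^ 2 ≤ (7 * (1 + ‖η‖)) ^ 2 := by nlinarith [norm_nonneg η]
    nlinarith [mul_nonneg (sq_nonneg ‖p.fst‖) (sq_nonneg ‖p.snd‖), sq_nonneg ‖p.fst‖]
  rw [norm_mul, norm_mul, Complex.norm_exp_ofReal_mul_I, one_mul, Complex.norm_real,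
    Real.norm_of_nonneg (fbiConst_nonneg hh)]
  have hα := fbiConst_le (d := d) hh hh1
  have hα0 := fbiConst_nonneg (d := d) hh
  have hs0 : 0 ≤ supSeminorm d M f := apply_nonneg _ _
  calc _ ≤ ((1 + ‖p.fst‖ ^ 2) ^ N * (7 ^ (2 * N) * (1 + ‖η‖) ^ (2 * N))) *
        (h⁻¹ ^ d * ‖𝓕 (window hh p.fst f : Conf d → ℂ) η‖) := by gcongr
    _ = 7 ^ (2 * N) * h⁻¹ ^ d * (1 + ‖p.fst‖ ^ 2) ^ N *
        ((1 + ‖η‖) ^ (2 * N) * ‖𝓕 (window hh p.fst f : Conf d → ℂ) η‖) := by ring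
    _ ≤ 7 ^ (2 * N) * h⁻¹ ^ d * (1 + ‖p.fst‖ ^ 2) ^ N *
        (2 ^ (2 * N) * supSeminorm d (2 * N) (𝓕 (window hh p.fst f))) := by gcongr
    _ = 7 ^ (2 * N) * 2 ^ (2 * N) * h⁻¹ ^ d * ((1 + ‖p.fst‖ ^ 2) ^ N *
        supSeminorm d (2 * N) (𝓕 (window hh p.fst f))) := by ring
    _ ≤ 7 ^ (2 * N) * 2 ^ (2 * N) * h⁻¹ ^ d * (C * (h⁻¹ ^ M * supSeminorm d M f)) := by
        gcongr
    _ = 7 ^ (2 * N) * 2 ^ (2 * N) * C * (h⁻¹ ^ (M + d) * supSeminorm d M f) := by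
        rw [pow_add]; ring
    _ ≤ _ := by
        gcongr
        exact supSeminorm_mono (by omega) f

/-! ### Inversion of the FBI transform -/

/-- Integration over the frequency is Fourier inversion for the windowed function. It returns `f y`
with one Gaussian factor; the kernel contributes a second, which doubles the exponent. -/
theorem integral_fbi_mul_exp {h : ℝ} (hh : 0 < h) (f : 𝓢(Conf d, ℂ)) (a y : Conf d) :
    ∫ b, fbi h f (pt a b) * Complex.exp (fbiPhase h (pt a (-b)) y) =
      fbiConst d h * (2 * Real.pi * h : ℝ) ^ d *
        (Real.exp (-h⁻¹ * ‖a - y‖ ^ 2) : ℝ) * f y := by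
  have hc : 0 < 2 * Real.pi * h := by positivity
  set g := window hh a f with hg
  set F : Conf d → ℂ := fun η => Complex.exp (((2 * Real.pi * inner ℝ η y : ℝ) : ℂ) * Complex.I) •
    𝓕 (g : Conf d → ℂ) η with hF
  have h1 : ∀ b, fbi h f (pt a b) * Complex.exp (fbiPhase h (pt a (-b)) y) =
      (fbiConst d h * (Real.exp (-(1 / (2 * h)) * ‖a - y‖ ^ 2) : ℝ) : ℂ) *
        F ((2 * Real.pi * h)⁻¹ • b) := by
    intro b
    simp only [hF]
    rw [fbi_eq_fourier hh, smul_eq_mul, real_inner_smul_left, fbiPhase, Complex.exp_add,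
      Complex.ofReal_exp, pt_fst, pt_snd]
    have h2 : Complex.exp (((2 * Real.pi * ((2 * Real.pi * h)⁻¹ * inner ℝ b y) : ℝ) : ℂ) *
        Complex.I) = Complex.exp (((1 / h * inner ℝ a b : ℝ) : ℂ) * Complex.I) *
          Complex.exp (((1 / h * inner ℝ (a - y) (-b) : ℝ) : ℂ) * Complex.I) := by
      rw [← Complex.exp_add, ← add_mul, ← Complex.ofReal_add]
      congr 3
      rw [inner_neg_right, inner_sub_left, real_inner_comm y b]
      field_simp
      ring
    rw [h2]
    ring
  have h3 : ∫ η, F η = g y := by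
    have h4 : 𝓕⁻ (𝓕 (g : Conf d → ℂ)) y = g y := by
      have h5 : 𝓕⁻ (𝓕 g : 𝓢(Conf d, ℂ)) = g := FourierTransform.fourierInv_fourier_eq g
      have := congrArg (fun φ : 𝓢(Conf d, ℂ) => φ y) h5
      simpa only [SchwartzMap.fourierInv_coe, SchwartzMap.fourier_coe] using this
    rw [← h4, Real.fourierInv_eq']
  simp_rw [h1]
  rw [MeasureTheory.integral_const_mul, MeasureTheory.Measure.integral_comp_inv_smul, h3, hg,
    window_apply, finrank_euclideanSpace_fin, abs_of_pos (by positivity), Complex.real_smul]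
  have h5 : Real.exp (-h⁻¹ * ‖a - y‖ ^ 2) = Real.exp (-(1 / (2 * h)) * ‖a - y‖ ^ 2) *
      Real.exp (-(1 / (2 * h)) * ‖a - y‖ ^ 2) := by
    rw [← Real.exp_add]
    congr 1
    field_simp
    ring
  rw [h5]
  push_cast
  ring

theorem integral_exp_neg_sub {h : ℝ} (hh : 0 < h) (y : Conf d) :
    ∫ a : Conf d, Real.exp (-h⁻¹ * ‖a - y‖ ^ 2) = (Real.pi * h) ^ ((d : ℝ) / 2) := by
  rw [MeasureTheory.integral_sub_right_eq_self (fun a => Real.exp (-h⁻¹ * ‖a‖ ^ 2)) y,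
    GaussianFourier.integral_rexp_neg_mul_sq_norm (by positivity), finrank_euclideanSpace_fin,
    div_inv_eq_mul]

/-- The inversion formula `T_h^* T_h f = f`. -/
theorem fbi_inversion {h : ℝ} (hh : 0 < h) (f : 𝓢(Conf d, ℂ)) (y : Conf d)
    (hint : MeasureTheory.Integrable fun z : Conf d × Conf d =>
      fbi h f (pt z.1 z.2) * Complex.exp (fbiPhase h (pt z.1 (-z.2)) y)) :
    ∫ z : Conf d × Conf d, (fbi h f (pt z.1 z.2) * fbiConst d h) *
      Complex.exp (fbiPhase h (pt z.1 (-z.2)) y) = f y := by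
  have h1 : ∀ z : Conf d × Conf d, (fbi h f (pt z.1 z.2) * fbiConst d h) *
      Complex.exp (fbiPhase h (pt z.1 (-z.2)) y) = fbiConst d h *
      (fbi h f (pt z.1 z.2) * Complex.exp (fbiPhase h (pt z.1 (-z.2)) y)) := fun z => by ring
  simp_rw [h1]
  rw [MeasureTheory.integral_const_mul, MeasureTheory.Measure.volume_eq_prod,
    MeasureTheory.integral_prod _ hint]
  simp_rw [integral_fbi_mul_exp hh]
  rw [MeasureTheory.integral_mul_const, MeasureTheory.integral_const_mul, integral_complex_ofReal,
    integral_exp_neg_sub hh]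
  have h2 := congrArg (fun r : ℝ => (r : ℂ)) (fbiConst_sq_mul (d := d) hh)
  push_cast at h2 ⊢
  calc _ = ((fbiConst d h : ℂ) ^ 2 * (2 * Real.pi * h) ^ d *
        (((Real.pi * h) ^ ((d : ℝ) / 2) : ℝ) : ℂ)) * f y := by ring
    _ = f y := by rw [h2, one_mul]

/-! ### The FBI transform of the kernel -/

/-- Two Gaussians centred at `p.fst` and `q.fst` multiply to one centred at the midpoint `m`, with a
constant from the parallelogram law. What remains is the Fourier transform of a Gaussian at `p.snd +
q.snd`, so the peak lies at the reflection of `q`. -/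
theorem norm_fbi_fbiKernel {h : ℝ} (hh : 0 < h) (p q : Phase d) :
    ‖fbi h (fbiKernel h hh q) p‖ = fbiConst d h * (Real.pi * h) ^ ((d : ℝ) / 2) *
      Real.exp (-(‖p.fst - q.fst‖ ^ 2 + ‖p.snd + q.snd‖ ^ 2) / 4 * h⁻¹) := by
  set m : Conf d := (1 / 2 : ℝ) • (p.fst + q.fst) with hm
  set w : Conf d := p.snd + q.snd with hw
  set θ : ℝ := h⁻¹ * (inner ℝ (p.fst - m) p.snd + inner ℝ (q.fst - m) q.snd) with hθ
  have hpt : ∀ v : Conf d, Complex.exp (fbiPhase h p (v + m)) * fbiKernel h hh q (v + m) =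
      (Complex.exp ((-‖p.fst - q.fst‖ ^ 2 / 4 * h⁻¹ : ℝ) : ℂ) * Complex.exp ((θ : ℂ) * Complex.I)) *
      Complex.exp (-((h⁻¹ : ℝ) : ℂ) * (‖v‖ : ℂ) ^ 2 +
        (-((h⁻¹ : ℝ) : ℂ) * Complex.I) * ((inner ℝ w v : ℝ) : ℂ)) := by
    intro v
    rw [fbiKernel_apply, ← Complex.exp_add, ← Complex.exp_add, ← Complex.exp_add]
    congr 1
    have e1 : ‖p.fst - (v + m)‖ ^ 2 + ‖q.fst - (v + m)‖ ^ 2 =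
        2 * ‖v‖ ^ 2 + ‖p.fst - q.fst‖ ^ 2 / 2 := by
      have f1 : p.fst - (v + m) = (1 / 2 : ℝ) • (p.fst - q.fst) - v := by
        rw [hm]; module
      have f2 : q.fst - (v + m) = -((1 / 2 : ℝ) • (p.fst - q.fst) + v) := by
        rw [hm]; module
      have f3 := parallelogram_law_with_norm ℝ ((1 / 2 : ℝ) • (p.fst - q.fst)) v
      have f4 : ‖(1 / 2 : ℝ) • (p.fst - q.fst)‖ = 1 / 2 * ‖p.fst - q.fst‖ := by
        rw [norm_smul, Real.norm_of_nonneg (by norm_num)]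
      rw [f4] at f3
      rw [f1, f2, norm_neg]
      nlinarith
    have e2 : inner ℝ (p.fst - (v + m)) p.snd + inner ℝ (q.fst - (v + m)) q.snd =
        inner ℝ (p.fst - m) p.snd + inner ℝ (q.fst - m) q.snd - inner ℝ w v := by
      rw [hw, real_inner_comm v]
      simp only [inner_sub_left, inner_add_left, inner_add_right]
      ring
    have e1' := congrArg (fun r : ℝ => (r : ℂ)) e1
    have e2' := congrArg (fun r : ℝ => (r : ℂ)) e2
    simp only [fbiPhase, hθ]
    push_cast at e1' e2' ⊢
    linear_combination (-(1 / (2 * (h : ℂ)))) * e1' + (h : ℂ)⁻¹ * Complex.I * e2'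
  rw [fbi, ← MeasureTheory.integral_add_right_eq_self _ m]
  simp_rw [hpt]
  rw [MeasureTheory.integral_const_mul,
    GaussianFourier.integral_cexp_neg_mul_sq_norm_add (by simpa using hh), norm_mul, norm_mul,
    norm_mul, norm_mul, Complex.norm_exp_ofReal_mul_I, Complex.norm_real,
    Real.norm_of_nonneg (fbiConst_nonneg hh), finrank_euclideanSpace_fin]
  have e3 : ‖((Real.pi : ℂ) / ((h⁻¹ : ℝ) : ℂ)) ^ ((d : ℂ) / 2)‖ =
      (Real.pi * h) ^ ((d : ℝ) / 2) := by
    have : ((Real.pi : ℂ) / ((h⁻¹ : ℝ) : ℂ)) = ((Real.pi * h : ℝ) : ℂ) := by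
      push_cast
      rw [div_inv_eq_mul]
    rw [this, Complex.norm_cpow_eq_rpow_re_of_pos (by positivity)]
    congr 1
    simp
  have e4 : (-((h⁻¹ : ℝ) : ℂ) * Complex.I) ^ 2 * (‖w‖ : ℂ) ^ 2 / (4 * ((h⁻¹ : ℝ) : ℂ)) =
      ((-‖w‖ ^ 2 / 4 * h⁻¹ : ℝ) : ℂ) := by
    have : (h : ℂ) ≠ 0 := by exact_mod_cast hh.ne'
    rw [mul_pow, Complex.I_sq]
    push_cast
    field_simp
  rw [e3, e4, Complex.norm_exp_ofReal, Complex.norm_exp_ofReal]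
  have e5 : -(‖p.fst - q.fst‖ ^ 2 + ‖w‖ ^ 2) / 4 * h⁻¹ =
      -‖p.fst - q.fst‖ ^ 2 / 4 * h⁻¹ + -‖w‖ ^ 2 / 4 * h⁻¹ := by ring
  rw [e5, Real.exp_add]
  ring

end

section

open scoped BoundedContinuousFunction
open MeasureTheory Filter

/-! ### Integrals of Schwartz functions under continuous linear maps -/

/-- Bounded continuous functions with values in `n`-linear maps, a home for `n`-th derivatives. -/
def DerivSpace (d n : ℕ) : Type := Conf d →ᵇ (Conf d [×n]→L[ℝ] ℂ)

namespace DerivSpace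

instance (n : ℕ) : NormedAddCommGroup (DerivSpace d n) :=
  inferInstanceAs (NormedAddCommGroup (Conf d →ᵇ (Conf d [×n]→L[ℝ] ℂ)))

instance (n : ℕ) : NormedSpace ℂ (DerivSpace d n) :=
  inferInstanceAs (NormedSpace ℂ (Conf d →ᵇ (Conf d [×n]→L[ℝ] ℂ)))

instance (n : ℕ) : CompleteSpace (DerivSpace d n) :=
  inferInstanceAs (CompleteSpace (Conf d →ᵇ (Conf d [×n]→L[ℝ] ℂ)))

/-- Evaluation at a point. -/
def eval {n : ℕ} (y : Conf d) : DerivSpace d n →L[ℂ] (Conf d [×n]→L[ℝ] ℂ) :=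
  BoundedContinuousFunction.evalCLM ℂ y

/-- Evaluation at a point and at a tuple of vectors. -/
def evalMultilinear {n : ℕ} (y : Conf d) (m : Fin n → Conf d) : DerivSpace d n →L[ℂ] ℂ :=
  LinearMap.mkContinuous
    { toFun := fun b => eval y b m
      map_add' := fun b c => by rw [map_add]; rfl
      map_smul' := fun a b => by rw [map_smul]; rfl }
    (∏ i, ‖m i‖) fun b => by
      rw [mul_comm]
      refine (ContinuousMultilinearMap.le_opNorm (eval y b) m).trans ?_
      gcongr
      exact BoundedContinuousFunction.norm_coe_le_norm (β := Conf d [×n]→L[ℝ] ℂ) b y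

theorem norm_eval_le {n : ℕ} (y : Conf d) (b : DerivSpace d n) : ‖eval y b‖ ≤ ‖b‖ :=
  BoundedContinuousFunction.norm_coe_le_norm (β := Conf d [×n]→L[ℝ] ℂ) b y

theorem ext_eval {n : ℕ} {b c : DerivSpace d n} (h : ∀ y, eval y b = eval y c) : b = c :=
  BoundedContinuousFunction.ext h

end DerivSpace

open DerivSpace (eval evalMultilinear norm_eval_le ext_eval)

theorem continuous_weighted_iteratedFDeriv (K n : ℕ) (f : 𝓢(Conf d, ℂ)) :
    Continuous fun y => ((1 + ‖y‖) ^ K : ℝ) • iteratedFDeriv ℝ n f y :=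
  (by fun_prop : Continuous fun y : Conf d => (1 + ‖y‖) ^ K).smul
    ((f.smooth ⊤).continuous_iteratedFDeriv (by exact_mod_cast le_top))

theorem norm_weighted_iteratedFDeriv_le (K n : ℕ) (f : 𝓢(Conf d, ℂ)) (y : Conf d) :
    ‖((1 + ‖y‖) ^ K : ℝ) • iteratedFDeriv ℝ n f y‖ ≤ 2 ^ (K + n) * supSeminorm d (K + n) f := by
  rw [norm_smul, Real.norm_of_nonneg (by positivity)]
  exact one_add_pow_mul_norm_iteratedFDeriv_le (by omega) (by omega) f y

/-- The function `(1 + |y|)^K D^n f` as a bounded continuous function. -/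
def weightedDerivFun (K n : ℕ) (f : 𝓢(Conf d, ℂ)) : DerivSpace d n :=
  BoundedContinuousFunction.ofNormedAddCommGroup _ (continuous_weighted_iteratedFDeriv K n f) _
    (norm_weighted_iteratedFDeriv_le K n f)

theorem eval_weightedDerivFun (K n : ℕ) (f : 𝓢(Conf d, ℂ)) (y : Conf d) :
    eval y (weightedDerivFun K n f) = ((1 + ‖y‖) ^ K : ℝ) • iteratedFDeriv ℝ n f y := rfl

/-- The map `f ↦ (1 + |y|)^K D^n f` into bounded continuous functions. -/
def weightedDeriv (d K n : ℕ) : 𝓢(Conf d, ℂ) →L[ℂ] DerivSpace d n :=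
  SchwartzMap.mkCLMtoNormedSpace (σ := RingHom.id ℂ) (weightedDerivFun K n)
    (fun f g => by
      refine ext_eval fun y => ?_
      have : iteratedFDeriv ℝ n (f + g : 𝓢(Conf d, ℂ)) y =
          iteratedFDeriv ℝ n f y + iteratedFDeriv ℝ n g y :=
        iteratedFDeriv_add_apply (f.contDiffAt n) (g.contDiffAt n)
      rw [map_add, eval_weightedDerivFun, this, smul_add]
      rfl)
    (fun c f => by
      refine ext_eval fun y => ?_
      have : iteratedFDeriv ℝ n (c • f : 𝓢(Conf d, ℂ)) y = c • iteratedFDeriv ℝ n f y :=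
        iteratedFDeriv_const_smul_apply (f.contDiffAt n)
      rw [RingHom.id_apply, map_smul, eval_weightedDerivFun, this, smul_comm]
      rfl)
    ⟨Finset.Iic (K + n, K + n), 2 ^ (K + n), by positivity, fun f =>
      BoundedContinuousFunction.norm_ofNormedAddCommGroup_le _
        (mul_nonneg (by positivity) (apply_nonneg _ _)) _⟩

theorem eval_weightedDeriv (K n : ℕ) (f : 𝓢(Conf d, ℂ)) (y : Conf d) :
    eval y (weightedDeriv d K n f) = ((1 + ‖y‖) ^ K : ℝ) • iteratedFDeriv ℝ n f y := rfl

theorem supSeminorm_le_sum_norm_weightedDeriv (K : ℕ) (f : 𝓢(Conf d, ℂ)) :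
    supSeminorm d K f ≤ ∑ n : Fin (K + 1), ‖weightedDeriv d K n f‖ := by
  refine Seminorm.finset_sup_apply_le (Finset.sum_nonneg fun _ _ => norm_nonneg _) ?_
  rintro ⟨k, n⟩ hkn
  obtain ⟨hk, hn⟩ : k ≤ K ∧ n ≤ K := Finset.mem_Iic.1 hkn
  refine le_trans ?_ (Finset.single_le_sum (f := fun n : Fin (K + 1) => ‖weightedDeriv d K n f‖)
    (fun _ _ => norm_nonneg _) (Finset.mem_univ (⟨n, by omega⟩ : Fin (K + 1))))
  refine SchwartzMap.seminorm_le_bound ℂ k n f (norm_nonneg _) fun y => ?_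
  refine le_trans ?_ (norm_eval_le y (weightedDeriv d K n f))
  rw [eval_weightedDeriv, norm_smul, Real.norm_of_nonneg (by positivity)]
  have h1 : ‖y‖ ^ k ≤ (1 + ‖y‖) ^ K :=
    (pow_le_pow_left₀ (norm_nonneg _) (by linarith) k).trans
      (pow_le_pow_right₀ (by linarith [norm_nonneg y]) hk)
  gcongr

/-- The weight is at least one, so both convergences hold uniformly without it; a uniform limit of
derivatives is the derivative of the limit, here of zero. -/
theorem tendsto_weightedDeriv_succ_eq_zero {K n : ℕ} {g : ℕ → 𝓢(Conf d, ℂ)}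
    {b : DerivSpace d (n + 1)}
    (h0 : Tendsto (fun j => weightedDeriv d K n (g j)) atTop (𝓝 0))
    (h1 : Tendsto (fun j => weightedDeriv d K (n + 1) (g j)) atTop (𝓝 b)) : b = 0 := by
  set e := continuousMultilinearCurryLeftEquiv ℝ (fun _ : Fin (n + 1) => Conf d) ℂ with he
  have hw : ∀ y : Conf d, 1 ≤ (1 + ‖y‖) ^ K := fun y =>
    one_le_pow₀ (by linarith [norm_nonneg y])
  have hderiv : ∀ (j : ℕ) (y : Conf d), HasFDerivAt (iteratedFDeriv ℝ n (g j))
      (e (iteratedFDeriv ℝ (n + 1) (g j) y)) y := by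
    intro j y
    have h2 : DifferentiableAt ℝ (iteratedFDeriv ℝ n (g j)) y :=
      ((g j).smooth ⊤).differentiable_iteratedFDeriv (m := n)
        (by exact_mod_cast ENat.natCast_lt_top n) y
    have h3 := h2.hasFDerivAt
    rwa [fderiv_iteratedFDeriv] at h3
  have hlim : ∀ y : Conf d, Tendsto (fun j => iteratedFDeriv ℝ n (g j) y) atTop (𝓝 0) := by
    intro y
    refine squeeze_zero_norm (fun j => ?_) (tendsto_zero_iff_norm_tendsto_zero.1 h0)
    refine le_trans ?_ (norm_eval_le y (weightedDeriv d K n (g j)))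
    rw [eval_weightedDeriv, norm_smul, Real.norm_of_nonneg (by positivity)]
    exact le_mul_of_one_le_left (norm_nonneg _) (hw y)
  have hunif : TendstoUniformly (fun j y => e (iteratedFDeriv ℝ (n + 1) (g j) y))
      (fun y => e (((1 + ‖y‖) ^ K)⁻¹ • eval y b)) atTop := by
    refine (Metric.tendstoUniformly_iff (α := Conf d →L[ℝ] (Conf d [×n]→L[ℝ] ℂ))).2 fun ε hε => ?_
    filter_upwards [(Metric.tendsto_nhds.1 h1) ε hε] with j hj y
    refine lt_of_le_of_lt ?_ hj
    rw [e.dist_map, dist_comm, dist_eq_norm, dist_eq_norm]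
    refine le_trans ?_ (norm_eval_le y (weightedDeriv d K (n + 1) (g j) - b))
    rw [map_sub, eval_weightedDeriv]
    have h2 : iteratedFDeriv ℝ (n + 1) (g j) y - ((1 + ‖y‖) ^ K)⁻¹ • eval y b =
        ((1 + ‖y‖) ^ K)⁻¹ • ((1 + ‖y‖) ^ K • iteratedFDeriv ℝ (n + 1) (g j) y - eval y b) := by
      rw [smul_sub, smul_smul, inv_mul_cancel₀ (by positivity), one_smul]
    rw [h2, norm_smul, norm_inv, Real.norm_of_nonneg (by positivity)]
    exact mul_le_of_le_one_left (norm_nonneg _) (inv_le_one_of_one_le₀ (hw y))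
  refine ext_eval fun y => ?_
  rw [map_zero]
  have h3 := hasFDerivAt_of_tendstoUniformly hunif hderiv hlim y
  have h4 := h3.unique (hasFDerivAt_const (0 : Conf d [×n]→L[ℝ] ℂ) y)
  have h5 : ((1 + ‖y‖) ^ K)⁻¹ • eval y b = 0 := e.map_eq_zero_iff.1 h4
  exact (smul_eq_zero.1 h5).resolve_left (by positivity)

variable {V : Type*} [NormedAddCommGroup V] [NormedSpace ℂ V]

/-- A map that is continuous for the norms of the weighted derivatives is closable with respect to
pointwise convergence. -/
theorem tendsto_zero_of_tendsto_weightedDeriv (u : 𝓢(Conf d, ℂ) →L[ℂ] V) {C : ℝ} {K : ℕ}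
    (hu : ∀ f, ‖u f‖ ≤ C * supSeminorm d K f) (hC : 0 ≤ C) {g : ℕ → 𝓢(Conf d, ℂ)}
    {b : ∀ n : Fin (K + 1), DerivSpace d n}
    (hb : ∀ n : Fin (K + 1), Tendsto (fun j => weightedDeriv d K n (g j)) atTop (𝓝 (b n)))
    (hb0 : b 0 = 0) : Tendsto (fun j => u (g j)) atTop (𝓝 0) := by
  have key : ∀ (n : ℕ) (hn : n < K + 1), b ⟨n, hn⟩ = 0 := by
    intro n
    induction n with
    | zero => exact fun _ => hb0
    | succ n ih =>
      intro hn
      have h0 := hb ⟨n, by omega⟩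
      rw [ih (by omega)] at h0
      exact tendsto_weightedDeriv_succ_eq_zero h0 (hb ⟨n + 1, hn⟩)
  have h1 : Tendsto (fun j => C * ∑ n : Fin (K + 1), ‖weightedDeriv d K n (g j)‖) atTop
      (𝓝 (C * ∑ _n : Fin (K + 1), (0 : ℝ))) := by
    refine (tendsto_finsetSum _ fun n _ => ?_).const_mul C
    have := hb n
    rw [key n n.2] at this
    exact tendsto_zero_iff_norm_tendsto_zero.1 this
  rw [Finset.sum_const_zero, mul_zero] at h1
  refine squeeze_zero_norm (fun j => (hu (g j)).trans ?_) h1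
  gcongr
  exact supSeminorm_le_sum_norm_weightedDeriv K (g j)

theorem exists_norm_le_supSeminorm {W : Type*} [NormedAddCommGroup W] [NormedSpace ℂ W]
    (u : 𝓢(Conf d, ℂ) →L[ℂ] W) :
    ∃ (C : ℝ) (M : ℕ), 0 < C ∧ ∀ f, ‖u f‖ ≤ C * supSeminorm d M f :=
  exists_le_supSeminorm ((normSeminorm ℂ W).comp (u : 𝓢(Conf d, ℂ) →ₗ[ℂ] W))
    (continuous_norm.comp u.continuous)

theorem integrable_clm_comp {X : Type*} [TopologicalSpace X] [SecondCountableTopology X]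
    [MeasurableSpace X] [OpensMeasurableSpace X] {μ : Measure X} {W : Type*}
    [NormedAddCommGroup W] [NormedSpace ℂ W] (u : 𝓢(Conf d, ℂ) →L[ℂ] W) {G : X → 𝓢(Conf d, ℂ)}
    (hG : Continuous G) (hint : ∀ M, Integrable (fun z => supSeminorm d M (G z)) μ) :
    Integrable (fun z => u (G z)) μ := by
  obtain ⟨C, M, -, hCM⟩ := exists_norm_le_supSeminorm u
  exact ((hint M).const_mul C).mono' (u.continuous.comp hG).aestronglyMeasurable
    (Eventually.of_forall fun z => hCM _)

/-- A continuous linear map on `𝓢` commutes with an absolutely convergent integral of Schwartz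
functions, given pointwise. -/
theorem clm_apply_eq_integral [CompleteSpace V] {X : Type*} [TopologicalSpace X]
    [SecondCountableTopology X] [MeasurableSpace X] [OpensMeasurableSpace X] {μ : Measure X}
    (u : 𝓢(Conf d, ℂ) →L[ℂ] V) {G : X → 𝓢(Conf d, ℂ)}
    (hG : Continuous G) (hint : ∀ M, Integrable (fun z => supSeminorm d M (G z)) μ)
    (f : 𝓢(Conf d, ℂ)) (hf : ∀ y, ∫ z, G z y ∂μ = f y) :
    u f = ∫ z, u (G z) ∂μ := by
  obtain ⟨C, K, hC, hu⟩ := exists_norm_le_supSeminorm u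
  let B := ∀ n : Fin (K + 1), DerivSpace d n
  let Ψ : 𝓢(Conf d, ℂ) →L[ℂ] B × V :=
    (ContinuousLinearMap.pi fun n : Fin (K + 1) => weightedDeriv d K n).prod u
  -- The space `𝓢` is not normed, so the Bochner integral is taken in the closure `W` of its image
  -- under the weighted derivatives together with `u`. The integral minus `Ψ f` is then a limit of
  -- some `Ψ (g j)`. Its zeroth component vanishes by the pointwise hypothesis, and closability
  -- forces the `V` component to vanish too.
  let W : Submodule ℂ (B × V) := (LinearMap.range (Ψ : 𝓢(Conf d, ℂ) →ₗ[ℂ] B × V)).topologicalClosure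
  have hW : IsClosed (W : Set (B × V)) := Submodule.isClosed_topologicalClosure _
  have : CompleteSpace W := hW.completeSpace_coe
  have hΨW : ∀ g, Ψ g ∈ W := fun g => Submodule.le_topologicalClosure _ ⟨g, rfl⟩
  let Ψ' : 𝓢(Conf d, ℂ) →L[ℂ] W := Ψ.codRestrict W hΨW
  have hJ : ∫ z, Ψ (G z) ∂μ = ((∫ z, Ψ' (G z) ∂μ : W) : B × V) :=
    W.subtypeL.integral_comp_comm (integrable_clm_comp Ψ' hG hint)
  have hJW : (∫ z, Ψ (G z) ∂μ) - Ψ f ∈ W := by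
    rw [hJ]
    exact W.sub_mem (Subtype.coe_prop _) (hΨW f)
  obtain ⟨s, hs, hlim⟩ := mem_closure_iff_seq_limit.1 hJW
  choose g hg using hs
  have hiΨ := integrable_clm_comp Ψ hG hint
  have hsnd : ((∫ z, Ψ (G z) ∂μ) - Ψ f).2 = (∫ z, u (G z) ∂μ) - u f := by
    rw [Prod.snd_sub]
    congr 1
    exact ((ContinuousLinearMap.snd ℂ B V).integral_comp_comm hiΨ).symm
  have hfst : ((∫ z, Ψ (G z) ∂μ) - Ψ f).1 0 = 0 := by
    have h1 : (∫ z, Ψ (G z) ∂μ).1 0 = ∫ z, weightedDeriv d K 0 (G z) ∂μ :=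
      (((ContinuousLinearMap.proj (R := ℂ)
        (φ := fun n : Fin (K + 1) => DerivSpace d n) 0).comp
        (ContinuousLinearMap.fst ℂ B V)).integral_comp_comm hiΨ).symm
    refine sub_eq_zero.2 (h1.trans ?_)
    refine ext_eval fun y => ContinuousMultilinearMap.ext fun m => ?_
    have h2 : eval y (∫ z, weightedDeriv d K 0 (G z) ∂μ) m =
        ∫ z, eval y (weightedDeriv d K 0 (G z)) m ∂μ :=
      ((evalMultilinear y m).integral_comp_comm
          (integrable_clm_comp (weightedDeriv d K 0) hG hint)).symm
    refine h2.trans ?_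
    have h3 : ∀ g : 𝓢(Conf d, ℂ), eval y (weightedDeriv d K 0 g) m = ((1 + ‖y‖) ^ K : ℝ) • g y :=
      fun g => by rw [eval_weightedDeriv]; simp
    simp_rw [h3]
    rw [integral_smul, hf y]
    exact (h3 f).symm
  have hlim' : Tendsto (fun j => Ψ (g j)) atTop (𝓝 ((∫ z, Ψ (G z) ∂μ) - Ψ f)) := by
    have : (fun j => Ψ (g j)) = s := funext hg
    rwa [this]
  have hl1 := (continuous_fst.tendsto _).comp hlim'
  have hl2 := (continuous_snd.tendsto _).comp hlim'
  have h0 := tendsto_zero_of_tendsto_weightedDeriv u hu hC.le (g := g)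
    (fun n => (tendsto_pi_nhds.1 hl1) n) hfst
  rw [hsnd] at hl2
  exact (sub_eq_zero.1 (tendsto_nhds_unique hl2 h0)).symm

end

section

open MeasureTheory Filter

/-! ### Duality between the FBI transforms of distributions and Schwartz functions -/

theorem fbi_eq_clm {h : ℝ} (hh : 0 < h) (f : 𝓢(Conf d, ℂ)) (p : Phase d) :
    fbi h f p = fbiConst d h *
      SchwartzMap.integralCLM ℂ volume (mulSchwartz f (fbiKernel h hh p)) := by
  rw [fbi, SchwartzMap.integralCLM_apply]
  congr 2
  funext y
  rw [mulSchwartz_apply, fbiKernel_apply, mul_comm]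

theorem fbi_sub (h : ℝ) (hh : 0 < h) (f g : 𝓢(Conf d, ℂ)) (p : Phase d) :
    fbi h (f - g) p = fbi h f p - fbi h g p := by
  have h1 : mulSchwartz (f - g) (fbiKernel h hh p) =
      mulSchwartz f (fbiKernel h hh p) - mulSchwartz g (fbiKernel h hh p) := by
    ext y
    simp [sub_mul]
  rw [fbi_eq_clm hh, fbi_eq_clm hh, fbi_eq_clm hh, h1, map_sub, mul_sub]

theorem continuous_fbi {h : ℝ} (hh : 0 < h) (hh1 : h ≤ 1) (f : 𝓢(Conf d, ℂ)) :
    Continuous fun z : Conf d × Conf d => fbi h f (pt z.1 z.2) := by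
  simp_rw [fbi_eq_clm hh]
  exact continuous_const.mul ((SchwartzMap.integralCLM ℂ volume).continuous.comp
    ((mulSchwartz f).continuous.comp (continuous_fbiKernel hh hh1)))

/-- An integrable weight on phase space. -/
def phaseWeight (z : Conf d × Conf d) : ℝ := ((1 + ‖z‖) ^ (2 * d + 1))⁻¹

theorem phaseWeight_nonneg (z : Conf d × Conf d) : 0 ≤ phaseWeight z := by
  unfold phaseWeight
  positivity

theorem integrable_phaseWeight : Integrable (phaseWeight (d := d)) := by
  have h1 : Integrable (fun z : Conf d × Conf d => (1 + ‖z‖) ^ (-(2 * d + 1 : ℝ))) := by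
    have : (volume : Measure (Conf d × Conf d)).IsAddHaarMeasure := by
      rw [Measure.volume_eq_prod]
      infer_instance
    refine integrable_one_add_norm ?_
    rw [Module.finrank_prod, finrank_euclideanSpace_fin]
    push_cast
    linarith
  refine h1.congr (Eventually.of_forall fun z => ?_)
  have h2 : (2 * d + 1 : ℝ) = ((2 * d + 1 : ℕ) : ℝ) := by push_cast; ring
  simp only [phaseWeight]
  rw [h2, Real.rpow_neg (by positivity), Real.rpow_natCast]

/-- Lets rapid decay of one transform pay both for the polynomial growth of the other and for
integrability over phase space. -/
theorem one_add_pow_le_phaseWeight (M : ℕ) :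
    ∃ (C : ℝ) (N : ℕ), 0 < C ∧ ∀ z : Conf d × Conf d, (1 + ‖z.1‖ + ‖z.2‖) ^ M ≤
      C * ((1 + ‖z.1‖ ^ 2 + ‖z.2‖ ^ 2) ^ N * phaseWeight z) := by
  set N := M + (2 * d + 1) with hN
  refine ⟨2 ^ M * 2 ^ N, N, by positivity, fun z => ?_⟩
  have h1 : 1 + ‖z.1‖ + ‖z.2‖ ≤ 2 * (1 + ‖z‖) := by
    linarith [norm_fst_le z, norm_snd_le z]
  have h2 : (1 + ‖z‖) ^ 2 ≤ 2 * (1 + ‖z.1‖ ^ 2 + ‖z.2‖ ^ 2) := by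
    have h3 : ‖z‖ ^ 2 ≤ ‖z.1‖ ^ 2 + ‖z.2‖ ^ 2 := by
      rw [Prod.norm_def]
      rcases max_cases ‖z.1‖ ‖z.2‖ with h | h <;> rw [h.1] <;> nlinarith
    nlinarith [sq_nonneg (1 - ‖z‖)]
  have h4 : (1 + ‖z‖) ^ N ≤ 2 ^ N * (1 + ‖z.1‖ ^ 2 + ‖z.2‖ ^ 2) ^ N := by
    rw [← mul_pow]
    refine le_trans ?_ (pow_le_pow_left₀ (by positivity) h2 N)
    rw [← pow_mul]
    exact pow_le_pow_right₀ (by linarith [norm_nonneg z]) (by omega)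
  calc _ ≤ (2 * (1 + ‖z‖)) ^ M := by gcongr
    _ = 2 ^ M * ((1 + ‖z‖) ^ N * phaseWeight z) := by
        rw [mul_pow, phaseWeight, hN, pow_add _ M]
        field_simp
    _ ≤ 2 ^ M * ((2 ^ N * (1 + ‖z.1‖ ^ 2 + ‖z.2‖ ^ 2) ^ N) * phaseWeight z) := by
        have := phaseWeight_nonneg z
        gcongr
    _ = _ := by ring

variable {V : Type*} [NormedAddCommGroup V] [NormedSpace ℂ V]

/-- The pairing of a distribution with a Schwartz function in terms of the FBI transforms. -/
theorem dist_apply_eq_integral [CompleteSpace V] {h : ℝ} (hh : 0 < h) (hh1 : h ≤ 1)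
    (u : 𝓢'(Conf d, V)) (f : 𝓢(Conf d, ℂ)) :
    u f = ∫ z : Conf d × Conf d, fbi h f (pt z.1 z.2) • fbiDist h hh u (pt z.1 (-z.2)) := by
  set G : Conf d × Conf d → 𝓢(Conf d, ℂ) := fun z =>
    (fbi h f (pt z.1 z.2) * fbiConst d h) • fbiKernel h hh (pt z.1 (-z.2)) with hG
  have hcont : Continuous G := by
    refine ((continuous_fbi hh hh1 f).mul continuous_const).smul ?_
    exact (continuous_fbiKernel hh hh1).comp
      (by fun_prop : Continuous fun z : Conf d × Conf d => (z.1, -z.2))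
  have hint : ∀ M, Integrable fun z => supSeminorm d M (G z) := by
    intro M
    obtain ⟨C₁, M₁, hC₁, H₁⟩ := fbiKernel_le (supSeminorm d M) (continuous_supSeminorm M)
    obtain ⟨C₂, N, hC₂, H₂⟩ := one_add_pow_le_phaseWeight (d := d) M₁
    obtain ⟨C₃, M₃, hC₃, H₃⟩ := fbi_decay (d := d) N
    refine (integrable_phaseWeight.const_mul (fbiConst d h * C₁ * h⁻¹ ^ M₁ * C₂ *
      (C₃ * (h⁻¹ ^ M₃ * supSeminorm d M₃ f)))).mono'
      ((continuous_supSeminorm M).comp hcont).aestronglyMeasurable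
      (Eventually.of_forall fun z => ?_)
    rw [Real.norm_of_nonneg (apply_nonneg _ _), hG]
    simp only
    rw [map_smul_eq_mul, norm_mul, Complex.norm_real,
      Real.norm_of_nonneg (fbiConst_nonneg hh)]
    have h1 := H₁ h hh hh1 (pt z.1 (-z.2))
    have h2 := H₂ z
    have h3 := H₃ h hh hh1 f (pt z.1 z.2)
    rw [pt_fst, pt_snd] at h3
    rw [pt_fst, pt_snd, norm_neg, mul_pow] at h1
    have hα := fbiConst_nonneg (d := d) hh
    have hw := phaseWeight_nonneg z
    calc _ ≤ ‖fbi h f (pt z.1 z.2)‖ * fbiConst d h * (C₁ * (h⁻¹ ^ M₁ *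
          (C₂ * ((1 + ‖z.1‖ ^ 2 + ‖z.2‖ ^ 2) ^ N * phaseWeight z)))) := by
          refine mul_le_mul_of_nonneg_left (h1.trans ?_) (by positivity)
          gcongr
      _ = fbiConst d h * C₁ * h⁻¹ ^ M₁ * C₂ * ((1 + ‖z.1‖ ^ 2 + ‖z.2‖ ^ 2) ^ N *
          ‖fbi h f (pt z.1 z.2)‖) * phaseWeight z := by ring
      _ ≤ _ := by gcongr
  have hpt : ∀ (z : Conf d × Conf d) (y : Conf d), G z y =
      (fbi h f (pt z.1 z.2) * fbiConst d h) * Complex.exp (fbiPhase h (pt z.1 (-z.2)) y) :=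
    fun z y => by simp [hG]
  have hα : (fbiConst d h : ℂ) ≠ 0 := by
    have h1 := fbiConst_sq_mul (d := d) hh
    intro h0
    rw [Complex.ofReal_eq_zero.1 h0] at h1
    simp at h1
  have hinv : ∀ y, ∫ z, G z y = f y := by
    intro y
    simp_rw [hpt]
    refine fbi_inversion hh f y ?_
    -- Point evaluation is continuous on `𝓢`, so the seminorm integrability just proved covers the
    -- scalar integrand, up to the nonzero factor `α_h`.
    obtain ⟨ev, hev⟩ : ∃ ev : 𝓢(Conf d, ℂ) →L[ℂ] ℂ, ∀ g, ev g = g y :=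
      ⟨(BoundedContinuousFunction.evalCLM ℂ y).comp
        (SchwartzMap.toBoundedContinuousFunctionCLM ℂ (Conf d) ℂ), fun g => by simp⟩
    refine ((integrable_clm_comp ev hcont hint).const_mul (fbiConst d h : ℂ)⁻¹).congr
      (Eventually.of_forall fun z => ?_)
    simp only [hev, hpt]
    field_simp
  have hmain := clm_apply_eq_integral (V := V) (u : 𝓢(Conf d, ℂ) →L[ℂ] V) hcont hint f hinv
  refine hmain.trans (integral_congr_ae (Eventually.of_forall fun z => ?_))
  simp only [hG, fbiDist]
  rw [smul_smul]
  exact map_smul _ _ _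

/-! ### Polynomial and exponential bounds in `h` -/

/-- Half of the exponential rate absorbs the power, by one term of the exponential series. -/
theorem inv_pow_mul_exp_le (M : ℕ) {δ : ℝ} (hδ : 0 < δ) :
    ∃ C : ℝ, 0 < C ∧ ∀ h : ℝ, 0 < h →
      h⁻¹ ^ M * Real.exp (-δ * h⁻¹) ≤ C * Real.exp (-(δ / 2) * h⁻¹) := by
  refine ⟨M.factorial / (δ / 2) ^ M, by positivity, fun h hh => ?_⟩
  have h1 := Real.pow_div_factorial_le_exp (δ / 2 * h⁻¹) (by positivity) M
  rw [mul_pow, div_le_iff₀ (by positivity)] at h1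
  have h2 : h⁻¹ ^ M ≤ M.factorial / (δ / 2) ^ M * Real.exp (δ / 2 * h⁻¹) := by
    rw [div_mul_eq_mul_div, le_div_iff₀ (by positivity)]
    linarith
  calc _ ≤ M.factorial / (δ / 2) ^ M * Real.exp (δ / 2 * h⁻¹) * Real.exp (-δ * h⁻¹) := by gcongr
    _ = _ := by
        rw [mul_assoc, ← Real.exp_add]
        congr 2
        ring

theorem rpow_neg_le_inv_pow {h : ℝ} (hh : 0 < h) (hh1 : h ≤ 1) (N : ℝ) :
    h ^ (-N) ≤ h⁻¹ ^ ⌈N⌉₊ := by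
  rw [inv_pow, ← Real.rpow_natCast, ← Real.rpow_neg hh.le]
  exact Real.rpow_le_rpow_of_exponent_ge hh hh1 (neg_le_neg (Nat.le_ceil N))

theorem PolyBddDist.exists_bound {u : ℝ → 𝓢'(Conf d, V)} (hu : PolyBddDist u) :
    ∃ (C : ℝ) (M : ℕ), 0 < C ∧ ∀ h : ℝ, 0 < h → h ≤ 1 → ∀ f : 𝓢(Conf d, ℂ),
      ‖u h f‖ ≤ C * (h⁻¹ ^ M * supSeminorm d M f) := by
  obtain ⟨q, hq, N, hN, H⟩ := hu
  obtain ⟨C, M, hC, hCM⟩ := exists_le_supSeminorm q hq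
  refine ⟨C, M + ⌈N⌉₊, hC, fun h hh hh1 f => (H h hh hh1 f).trans ?_⟩
  have hinv : 1 ≤ h⁻¹ := (one_le_inv₀ hh).2 hh1
  have hs0 : 0 ≤ supSeminorm d M f := apply_nonneg _ _
  calc _ ≤ h⁻¹ ^ ⌈N⌉₊ * (C * supSeminorm d M f) :=
        mul_le_mul (rpow_neg_le_inv_pow hh hh1 N) (hCM f) (apply_nonneg _ _) (by positivity)
    _ ≤ h⁻¹ ^ (M + ⌈N⌉₊) * (C * supSeminorm d (M + ⌈N⌉₊) f) := by
        gcongr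
        · omega
        · exact supSeminorm_mono (by omega) f
    _ = _ := by ring

theorem PolyBddDist.fbiDist_le {u : ℝ → 𝓢'(Conf d, V)} (hu : PolyBddDist u) :
    ∃ (C : ℝ) (M : ℕ), 0 < C ∧ ∀ (h : ℝ) (hh : 0 < h), h ≤ 1 → ∀ p : Phase d,
      ‖fbiDist h hh (u h) p‖ ≤ C * (h⁻¹ * (1 + ‖p.fst‖ + ‖p.snd‖)) ^ M := by
  obtain ⟨C₁, M₁, hC₁, H₁⟩ := hu.exists_bound
  obtain ⟨C₂, M₂, hC₂, H₂⟩ := fbiKernel_le (supSeminorm d M₁) (continuous_supSeminorm M₁)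
  refine ⟨C₁ * C₂, d + M₁ + M₂, by positivity, fun h hh hh1 p => ?_⟩
  have hinv : 1 ≤ h⁻¹ := (one_le_inv₀ hh).2 hh1
  have hX : 1 ≤ 1 + ‖p.fst‖ + ‖p.snd‖ := by linarith [norm_nonneg p.fst, norm_nonneg p.snd]
  have hα := fbiConst_le (d := d) hh hh1
  have hα0 := fbiConst_nonneg (d := d) hh
  set X := 1 + ‖p.fst‖ + ‖p.snd‖ with hXdef
  have h1 : h⁻¹ ^ (d + M₁) ≤ (h⁻¹ * X) ^ (d + M₁) :=
    pow_le_pow_left₀ (by positivity) (le_mul_of_one_le_right (by positivity) hX) _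
  rw [fbiDist, norm_smul, Complex.norm_real, Real.norm_of_nonneg hα0]
  calc _ ≤ h⁻¹ ^ d * (C₁ * (h⁻¹ ^ M₁ * (C₂ * (h⁻¹ * X) ^ M₂))) := by
        refine mul_le_mul hα ((H₁ h hh hh1 _).trans ?_) (norm_nonneg _) (by positivity)
        gcongr
        exact H₂ h hh hh1 p
    _ = C₁ * C₂ * (h⁻¹ ^ (d + M₁) * (h⁻¹ * X) ^ M₂) := by rw [pow_add]; ring
    _ ≤ C₁ * C₂ * ((h⁻¹ * X) ^ (d + M₁) * (h⁻¹ * X) ^ M₂) := by gcongr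
    _ = _ := by rw [← pow_add]

theorem PolyBddSchwartz.eventually_supSeminorm_le {f : ℝ → 𝓢(Conf d, ℂ)} (hf : PolyBddSchwartz f)
    (M : ℕ) : ∃ (C : ℝ) (K : ℕ), 0 < C ∧
      ∀ᶠ h in 𝓝[>] (0 : ℝ), supSeminorm d M (f h) ≤ C * h⁻¹ ^ K := by
  choose N hN hO using hf
  choose c hc0 hc using fun k n => (hO k n).exists_pos
  refine ⟨∑ i ∈ Finset.Iic (M, M), c i.1 i.2 + 1,
    (Finset.Iic (M, M)).sup fun i => ⌈N i.1 i.2⌉₊, ?_, ?_⟩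
  · have : 0 ≤ ∑ i ∈ Finset.Iic (M, M), c i.1 i.2 := Finset.sum_nonneg fun i _ => (hc0 _ _).le
    positivity
  have h1 : ∀ᶠ h in 𝓝[>] (0 : ℝ), ∀ i ∈ Finset.Iic (M, M),
      ‖SchwartzMap.seminorm ℂ i.1 i.2 (f h)‖ ≤ c i.1 i.2 * ‖h ^ (-N i.1 i.2)‖ :=
    (Finset.eventually_all _).2 fun i _ => (hc i.1 i.2).bound
  filter_upwards [h1, Ioc_mem_nhdsGT (zero_lt_one' ℝ)] with h hh ⟨h0, h1'⟩
  have hs : 0 ≤ ∑ i ∈ Finset.Iic (M, M), c i.1 i.2 := Finset.sum_nonneg fun i _ => (hc0 _ _).le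
  have hinv : 1 ≤ h⁻¹ := (one_le_inv₀ h0).2 h1'
  refine Seminorm.finset_sup_apply_le (by positivity) fun i hi => ?_
  refine (le_abs_self _).trans ((hh i hi).trans ?_)
  rw [Real.norm_of_nonneg (by positivity)]
  have h2 : c i.1 i.2 ≤ ∑ i ∈ Finset.Iic (M, M), c i.1 i.2 + 1 := by
    have := Finset.single_le_sum (f := fun i : ℕ × ℕ => c i.1 i.2) (fun i _ => (hc0 _ _).le) hi
    linarith
  refine mul_le_mul h2 ((rpow_neg_le_inv_pow h0 h1' _).trans (pow_le_pow_right₀ hinv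
    (Finset.le_sup (f := fun i : ℕ × ℕ => ⌈N i.1 i.2⌉₊) hi))) (by positivity) (by positivity)

/-! ### Geometry of phase space -/

theorem dist_sq_eq (p q : Phase d) :
    dist p q ^ 2 = ‖p.fst - q.fst‖ ^ 2 + ‖p.snd - q.snd‖ ^ 2 := by
  rw [dist_eq_norm, WithLp.prod_norm_sq_eq_of_L2]
  rfl

theorem dist_pt_neg (a b x ξ : Conf d) :
    dist (pt a (-b)) (pt x (-ξ)) = dist (pt a b) (pt x ξ) := by
  refine (pow_left_inj₀ dist_nonneg dist_nonneg two_ne_zero).1 ?_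
  rw [dist_sq_eq, dist_sq_eq]
  simp only [pt_fst, pt_snd]
  rw [← norm_neg (b - ξ), neg_sub_neg, neg_sub]

theorem norm_fst_sub_le_dist (p q : Phase d) : ‖p.fst - q.fst‖ ≤ dist p q := by
  refine le_of_sq_le_sq ?_ dist_nonneg
  rw [dist_sq_eq]
  linarith [sq_nonneg ‖p.snd - q.snd‖]

theorem norm_snd_sub_le_dist (p q : Phase d) : ‖p.snd - q.snd‖ ≤ dist p q := by
  refine le_of_sq_le_sq ?_ dist_nonneg
  rw [dist_sq_eq]
  linarith [sq_nonneg ‖p.fst - q.fst‖]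

theorem ofReal_lt_infEDist_ball {p c : Phase d} {r : ℝ} (hr : 0 < r) (h : r ≤ dist p c) :
    ENNReal.ofReal (r / 4) < Metric.infEDist p (Metric.ball c (r / 2)) := by
  refine lt_of_lt_of_le (b := ENNReal.ofReal (r / 2))
    ((ENNReal.ofReal_lt_ofReal_iff (by positivity)).2 (by linarith)) ?_
  refine Metric.le_infEDist.2 fun y hy => ?_
  rw [edist_dist]
  refine ENNReal.ofReal_le_ofReal ?_
  have := dist_triangle p y c
  rw [Metric.mem_ball] at hy
  linarith

theorem le_dist_of_infEDist_pos {p c : Phase d} {r ε : ℝ}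
    (h : ENNReal.ofReal ε < Metric.infEDist p (Metric.ball c r)) : r ≤ dist p c := by
  by_contra! hlt
  rw [Metric.infEDist_zero_of_mem (Metric.mem_ball.2 hlt)] at h
  exact not_lt_zero h

end

open MeasureTheory Filter

variable {V : Type*} [NormedAddCommGroup V] [NormedSpace ℂ V]

/-! ### Exponential smallness of pairings -/

/-- In the duality integral one factor is exponentially small at every phase space point: the
transform of `u` within `r` of `(x, ξ)`, that of `f` elsewhere. Compact supports play no role here.
-/
theorem isBigO_of_notMem_microsupport [CompleteSpace V] {u : ℝ → 𝓢'(Conf d, V)}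
    (hu : PolyBddDist u) {x ξ : Conf d} (hx : pt x (-ξ) ∉ microsupport u) :
    ∃ ε : ℝ, 0 < ε ∧ ∀ f : ℝ → 𝓢(Conf d, ℂ), PolyBddSchwartz f →
      UnifMicrosupportedIn f (Metric.ball (pt x ξ) ε) →
      ∃ δ : ℝ, 0 < δ ∧
        (fun h : ℝ => u h (f h)) =O[𝓝[>] (0 : ℝ)] fun h : ℝ => Real.exp (-δ * h⁻¹) := by
  simp only [microsupport, Set.mem_compl_iff, not_not, Set.mem_ofPred_eq] at hx
  obtain ⟨C₀, δ₀, hC₀, hδ₀, hev⟩ := hx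
  obtain ⟨r, hr, hball⟩ := Metric.eventually_nhds_iff.1 hev
  -- With radius `r / 2`, points at distance at least `r` from the centre are more than `r / 4` from
  -- the ball, so the two regions cover phase space.
  refine ⟨r / 2, by positivity, fun f hf hmic => ?_⟩
  obtain ⟨δ₁, hδ₁, hsmall⟩ := hmic (r / 4) (by positivity)
  obtain ⟨C₂, M₂, hC₂, H₂⟩ := hu.fbiDist_le
  obtain ⟨C₃, N, hC₃, H₃⟩ := one_add_pow_le_phaseWeight (d := d) M₂
  obtain ⟨C₄, hC₄, H₄⟩ := hsmall N
  obtain ⟨C₅, M₅, hC₅, H₅⟩ := fbi_decay (d := d) N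
  obtain ⟨C₆, K, hC₆, H₆⟩ := hf.eventually_supSeminorm_le M₅
  set δ := min δ₀ δ₁ with hδ
  have hδ0 : 0 < δ := lt_min hδ₀ hδ₁
  set L := M₂ + M₅ + K with hL
  set A := C₃ * (C₅ * C₆ * C₀ + C₄ * C₂) with hA
  have hA0 : 0 < A := by positivity
  obtain ⟨C₇, hC₇, H₇⟩ := inv_pow_mul_exp_le L hδ0
  refine ⟨δ / 2, by positivity, ?_⟩
  refine Asymptotics.IsBigO.of_bound (A * C₇ * ∫ z : Conf d × Conf d, phaseWeight z) ?_
  filter_upwards [H₆, Ioc_mem_nhdsGT (zero_lt_one' ℝ)] with h hsem ⟨hh, hh1⟩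
  have hinv : 1 ≤ h⁻¹ := (one_le_inv₀ hh).2 hh1
  have hexp₀ : Real.exp (-δ₀ * h⁻¹) ≤ Real.exp (-δ * h⁻¹) := by
    refine Real.exp_le_exp.2 (mul_le_mul_of_nonneg_right ?_ (by positivity))
    exact neg_le_neg (min_le_left _ _)
  have hexp₁ : Real.exp (-δ₁ * h⁻¹) ≤ Real.exp (-δ * h⁻¹) := by
    refine Real.exp_le_exp.2 (mul_le_mul_of_nonneg_right ?_ (by positivity))
    exact neg_le_neg (min_le_right _ _)
  rw [dist_apply_eq_integral hh hh1]
  have hbound : ∀ z : Conf d × Conf d,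
      ‖fbi h (f h) (pt z.1 z.2) • fbiDist h hh (u h) (pt z.1 (-z.2))‖ ≤
        A * (h⁻¹ ^ L * Real.exp (-δ * h⁻¹)) * phaseWeight z := by
    intro z
    have hw := phaseWeight_nonneg z
    set Q := (1 + ‖z.1‖ ^ 2 + ‖z.2‖ ^ 2) ^ N with hQ
    have hQ0 : 0 < Q := by positivity
    have hX := H₃ z
    have hX1 : 1 ≤ (1 + ‖z.1‖ + ‖z.2‖) ^ M₂ :=
      one_le_pow₀ (by linarith [norm_nonneg z.1, norm_nonneg z.2])
    rw [norm_smul]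
    by_cases hz : dist (pt z.1 z.2) (pt x ξ) < r
    · have h1 : ‖fbiDist h hh (u h) (pt z.1 (-z.2))‖ ≤ C₀ * Real.exp (-δ₀ * h⁻¹) :=
        (hball (by rw [dist_pt_neg]; exact hz) h hh hh1).le
      have h2 : Q * ‖fbi h (f h) (pt z.1 z.2)‖ ≤ C₅ * (h⁻¹ ^ M₅ * (C₆ * h⁻¹ ^ K)) :=
        (H₅ h hh hh1 (f h) (pt z.1 z.2)).trans (by gcongr)
      -- Inserting this factor brings in the integrable weight, and `Q` is absorbed by the decay of
      -- the transform of `f`.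
      have h3 : 1 ≤ C₃ * (Q * phaseWeight z) := hX1.trans hX
      calc _ ≤ (C₃ * (Q * phaseWeight z)) * (‖fbi h (f h) (pt z.1 z.2)‖ *
            ‖fbiDist h hh (u h) (pt z.1 (-z.2))‖) := le_mul_of_one_le_left (by positivity) h3
        _ = C₃ * phaseWeight z * (Q * ‖fbi h (f h) (pt z.1 z.2)‖) *
            ‖fbiDist h hh (u h) (pt z.1 (-z.2))‖ := by ring
        _ ≤ C₃ * phaseWeight z * (C₅ * (h⁻¹ ^ M₅ * (C₆ * h⁻¹ ^ K))) *
            (C₀ * Real.exp (-δ * h⁻¹)) := by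
            gcongr
            exact h1.trans (by gcongr)
        _ = C₃ * (C₅ * C₆ * C₀) * (h⁻¹ ^ (M₅ + K) * Real.exp (-δ * h⁻¹)) * phaseWeight z := by
            rw [pow_add]; ring
        _ ≤ _ := by
            rw [hA]
            have : 0 ≤ C₄ * C₂ := by positivity
            gcongr
            · linarith
            · omega
    · have h1 := H₄ h hh hh1 (pt z.1 z.2) (ofReal_lt_infEDist_ball hr (not_lt.1 hz))
      rw [norm_mul, Complex.norm_real, Real.norm_of_nonneg (by positivity), pt_fst, pt_snd,
        ← hQ] at h1
      have h2 := H₂ h hh hh1 (pt z.1 (-z.2))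
      rw [pt_fst, pt_snd, norm_neg, mul_pow] at h2
      calc _ ≤ ‖fbi h (f h) (pt z.1 z.2)‖ * (C₂ * (h⁻¹ ^ M₂ * (C₃ * (Q * phaseWeight z)))) := by
            refine mul_le_mul_of_nonneg_left (h2.trans ?_) (norm_nonneg _)
            gcongr
        _ = C₃ * C₂ * (Q * ‖fbi h (f h) (pt z.1 z.2)‖) * h⁻¹ ^ M₂ * phaseWeight z := by ring
        _ ≤ C₃ * C₂ * (C₄ * Real.exp (-δ * h⁻¹)) * h⁻¹ ^ L * phaseWeight z := by
            have h3 : h⁻¹ ^ M₂ ≤ h⁻¹ ^ L := pow_le_pow_right₀ hinv (by omega)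
            have h4 := h1.trans (mul_le_mul_of_nonneg_left hexp₁ hC₄.le)
            gcongr ?_ * ?_ * ?_ * ?_
        _ = C₃ * (C₄ * C₂) * (h⁻¹ ^ L * Real.exp (-δ * h⁻¹)) * phaseWeight z := by ring
        _ ≤ _ := by
            rw [hA]
            have : 0 ≤ C₅ * C₆ * C₀ := by positivity
            gcongr
            linarith
  refine (norm_integral_le_of_norm_le (integrable_phaseWeight.const_mul _)
    (Eventually.of_forall hbound)).trans ?_
  rw [integral_const_mul, Real.norm_of_nonneg (Real.exp_nonneg _)]
  have hI : 0 ≤ ∫ z : Conf d × Conf d, phaseWeight z := integral_nonneg phaseWeight_nonneg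
  calc _ ≤ A * (C₇ * Real.exp (-(δ / 2) * h⁻¹)) * ∫ z : Conf d × Conf d, phaseWeight z := by
        exact mul_le_mul_of_nonneg_right (mul_le_mul_of_nonneg_left (H₇ h hh) hA0.le) hI
    _ = _ := by ring

/-! ### Truncated kernels as test families -/

/-- A smooth cutoff equal to one near the ball of radius `r` around `x`, as a Schwartz function. -/
theorem exists_cutoff (x : Conf d) {r : ℝ} (hr : 0 < r) :
    ∃ χ : 𝓢(Conf d, ℂ), tsupport χ ⊆ Metric.closedBall x (r + 2) ∧
      ∀ y ∈ Metric.ball x (r + 1), χ y = 1 := by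
  let b : ContDiffBump x := ⟨r + 1, r + 2, by linarith, by linarith⟩
  have hsmooth : ContDiff ℝ ∞ fun y => ((b y : ℝ) : ℂ) :=
    Complex.ofRealCLM.contDiff.comp b.contDiff
  have hsupp : tsupport (fun y => ((b y : ℝ) : ℂ)) ⊆ Metric.closedBall x (r + 2) := by
    refine (closure_mono ?_).trans b.tsupport_eq.subset
    intro y hy
    rw [Function.mem_support] at hy ⊢
    exact fun h => hy (by rw [h, Complex.ofReal_zero])
  have hcomp : HasCompactSupport fun y => ((b y : ℝ) : ℂ) :=
    HasCompactSupport.intro' (isCompact_closedBall x (r + 2)) Metric.isClosed_closedBall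
      fun y hy => image_eq_zero_of_notMem_tsupport (f := fun y => ((b y : ℝ) : ℂ))
        fun h => hy (hsupp h)
  refine ⟨hcomp.toSchwartzMap hsmooth, hsupp, fun y hy => ?_⟩
  have : b y = 1 := b.one_of_mem_closedBall (Metric.ball_subset_closedBall hy)
  change ((b y : ℝ) : ℂ) = 1
  rw [this, Complex.ofReal_one]

theorem one_sub_schwartz_bounded (χ : 𝓢(Conf d, ℂ)) (n : ℕ) :
    ∃ A : ℝ, ∀ y, ‖iteratedFDeriv ℝ n (fun y => 1 - χ y) y‖ ≤ A := by
  refine ⟨1 + SchwartzMap.seminorm ℂ 0 n χ, fun y => ?_⟩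
  have h1 : iteratedFDeriv ℝ n ((fun _ : Conf d => (1 : ℂ)) - (χ : Conf d → ℂ)) y =
      iteratedFDeriv ℝ n (fun _ : Conf d => (1 : ℂ)) y - iteratedFDeriv ℝ n χ y :=
    iteratedFDeriv_sub_apply contDiffAt_const (χ.contDiffAt n)
  have h2 : ‖iteratedFDeriv ℝ n (fun _ : Conf d => (1 : ℂ)) y‖ ≤ 1 := by
    rcases n with _ | n
    · simp
    · simp [iteratedFDeriv_const_of_ne (Nat.succ_ne_zero n)]
  change ‖iteratedFDeriv ℝ n ((fun _ : Conf d => (1 : ℂ)) - (χ : Conf d → ℂ)) y‖ ≤ _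
  rw [h1]
  exact (norm_sub_le _ _).trans (add_le_add h2 (SchwartzMap.norm_iteratedFDeriv_le_seminorm ℂ χ n y))

theorem one_add_norm_le_of_mem_ball {x ξ : Conf d} {r : ℝ} {p : Phase d}
    (hp : p ∈ Metric.ball (pt x (-ξ)) r) :
    1 + ‖p.fst‖ + ‖p.snd‖ ≤ 1 + (‖x‖ + r) + (‖ξ‖ + r) := by
  have hp' : dist p (pt x (-ξ)) < r := hp
  have h1 : ‖p.fst - x‖ < r := (norm_fst_sub_le_dist p (pt x (-ξ))).trans_lt hp'
  have h2 : ‖p.snd - -ξ‖ < r := (norm_snd_sub_le_dist p (pt x (-ξ))).trans_lt hp'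
  have e1 := norm_le_norm_add_norm_sub' p.fst x
  have e2 := norm_le_norm_add_norm_sub' p.snd (-ξ)
  rw [norm_neg] at e2
  linarith

section TruncatedKernel

variable (χ : 𝓢(Conf d, ℂ)) (x ξ : Conf d) {r : ℝ}

/-- The FBI kernel multiplied by `1 - χ`. -/
def kernelTail {h : ℝ} (hh : 0 < h) (p : Phase d) : 𝓢(Conf d, ℂ) :=
  fbiKernel h hh p - mulSchwartz χ (fbiKernel h hh p)

/-- The centre of the kernel is within `r` of `x`, so `1 - χ` vanishes on the unit ball around it.
Taking `ρ = 1` gives the rate `1 / 4`, half of which is spent on powers of `h⁻¹`. -/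
theorem exists_kernelTail_le (hr : 0 < r) (hχ : ∀ y ∈ Metric.ball x (r + 1), χ y = 1)
    (q : Seminorm ℂ 𝓢(Conf d, ℂ)) (hq : Continuous q) (L : ℕ) :
    ∃ C : ℝ, 0 < C ∧ ∀ (h : ℝ) (hh : 0 < h), h ≤ 1 → ∀ p ∈ Metric.ball (pt x (-ξ)) r,
      h⁻¹ ^ L * q (kernelTail χ hh p) ≤ C * Real.exp (-(1 / 8) * h⁻¹) := by
  obtain ⟨C, M, hC, H⟩ := cutoff_fbiKernel_le (fun y => 1 - χ y)
    (contDiff_const.sub (χ.smooth ⊤)) (one_sub_schwartz_bounded χ) q hq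
  obtain ⟨C', hC', H'⟩ := inv_pow_mul_exp_le (L + M) (δ := 1 / 4) (by norm_num)
  set R := 1 + (‖x‖ + r) + (‖ξ‖ + r) with hR
  refine ⟨C * R ^ M * C', by positivity, fun h hh hh1 p hp => ?_⟩
  have h1 : ‖p.fst - x‖ < r :=
    (norm_fst_sub_le_dist p (pt x (-ξ))).trans_lt (Metric.mem_ball.1 hp)
  have h3 : 1 + ‖p.fst‖ + ‖p.snd‖ ≤ R := one_add_norm_le_of_mem_ball hp
  have h4 := H h hh hh1 p 1 zero_le_one (fun y hy => by
    rw [hχ y, sub_self]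
    rw [Metric.mem_ball] at hy ⊢
    have := dist_triangle y p.fst x
    rw [dist_eq_norm p.fst x] at this
    linarith) (kernelTail χ hh p) (fun y => by
      simp [kernelTail]
      ring)
  have h5 := H' h hh
  calc _ ≤ h⁻¹ ^ L * (C * ((h⁻¹ * R) ^ M * Real.exp (-(1 ^ 2 / 4) * h⁻¹))) := by
        gcongr
        exact h4.trans (by gcongr)
    _ = C * R ^ M * (h⁻¹ ^ (L + M) * Real.exp (-(1 / 4) * h⁻¹)) := by
        rw [mul_pow, pow_add, one_pow]; ring
    _ ≤ C * R ^ M * (C' * Real.exp (-(1 / 4 / 2) * h⁻¹)) := by gcongr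
    _ = _ := by
        have : (1 / 4 / 2 : ℝ) = 1 / 8 := by norm_num
        rw [this]
        ring

/-- The truncated kernels centred at points `P h`. -/
def truncatedKernel (P : ℝ → Phase d) (h : ℝ) : 𝓢(Conf d, ℂ) :=
  if hh : 0 < h then mulSchwartz χ (fbiKernel h hh (P h)) else 0

variable {χ x ξ} {P : ℝ → Phase d}

theorem truncatedKernel_eq {h : ℝ} (hh : 0 < h) :
    truncatedKernel χ P h = fbiKernel h hh (P h) - kernelTail χ hh (P h) := by
  rw [truncatedKernel, dif_pos hh, kernelTail, sub_sub_cancel]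

theorem polyBddTest_truncatedKernel (hr : 0 < r)
    (hχs : tsupport χ ⊆ Metric.closedBall x (r + 2))
    (hχ : ∀ y ∈ Metric.ball x (r + 1), χ y = 1)
    (hP : ∀ h, 0 < h → h ≤ 1 → P h ∈ Metric.ball (pt x (-ξ)) r) :
    PolyBddTest (truncatedKernel χ P) := by
  refine ⟨⟨Metric.closedBall x (r + 2), isCompact_closedBall _ _, fun h hh _ => ?_⟩,
    fun k n => ?_⟩
  · rw [truncatedKernel, dif_pos hh]
    refine (closure_mono fun y hy => ?_).trans hχs
    rw [Function.mem_support, mulSchwartz_apply] at hy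
    exact left_ne_zero_of_mul hy
  · have hq : Continuous (SchwartzMap.seminorm ℂ k n : Seminorm ℂ 𝓢(Conf d, ℂ)) :=
      (schwartz_withSeminorms ℂ (Conf d) ℂ).continuous_seminorm (k, n)
    obtain ⟨C₁, M, hC₁, H₁⟩ := fbiKernel_le _ hq
    obtain ⟨C₂, hC₂, H₂⟩ := exists_kernelTail_le χ x ξ hr hχ _ hq 0
    set R := 1 + (‖x‖ + r) + (‖ξ‖ + r) with hR
    -- The exponent must be positive, and `M` may be zero.
    refine ⟨M + 1, by positivity, Asymptotics.IsBigO.of_bound (C₁ * R ^ M + C₂) ?_⟩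
    filter_upwards [Ioc_mem_nhdsGT (zero_lt_one' ℝ)] with h ⟨hh, hh1⟩
    have hinv : 1 ≤ h⁻¹ := (one_le_inv₀ hh).2 hh1
    have h3 : 1 + ‖(P h).fst‖ + ‖(P h).snd‖ ≤ R := one_add_norm_le_of_mem_ball (hP h hh hh1)
    have h4 : h ^ (-((M : ℝ) + 1)) = h⁻¹ ^ (M + 1) := by
      rw [Real.rpow_neg hh.le, inv_pow]
      exact_mod_cast rfl
    have h5 := H₂ h hh hh1 (P h) (hP h hh hh1)
    rw [pow_zero, one_mul] at h5
    have h6 : Real.exp (-(1 / 8) * h⁻¹) ≤ h⁻¹ ^ (M + 1) :=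
      (Real.exp_le_one_iff.2 (by nlinarith)).trans (one_le_pow₀ hinv)
    have h7 : h⁻¹ ^ M ≤ h⁻¹ ^ (M + 1) := pow_le_pow_right₀ hinv (by omega)
    rw [h4, Real.norm_of_nonneg (apply_nonneg _ _), Real.norm_of_nonneg (by positivity),
      truncatedKernel_eq hh]
    refine (map_sub_le_add (SchwartzMap.seminorm ℂ k n) _ _).trans ?_
    calc _ ≤ C₁ * (h⁻¹ * R) ^ M + C₂ * Real.exp (-(1 / 8) * h⁻¹) := by
          refine add_le_add ((H₁ h hh hh1 (P h)).trans ?_) h5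
          gcongr
      _ = C₁ * R ^ M * h⁻¹ ^ M + C₂ * Real.exp (-(1 / 8) * h⁻¹) := by rw [mul_pow]; ring
      _ ≤ C₁ * R ^ M * h⁻¹ ^ (M + 1) + C₂ * h⁻¹ ^ (M + 1) := by
          have : 0 ≤ C₁ * R ^ M := by positivity
          gcongr
      _ = _ := by ring

/-- The reflected centre `q'` is within `r` of `(x, ξ)`, so `p` is at distance `t ≥ r` from it. Half
of the exponent `t² / (4h)` controls the weight, the rest gives `r² / (8h)`, and half of that rate
absorbs the `h⁻ᵈ` bounding `α_h`. -/
theorem exists_fbi_fbiKernel_le (hr : 0 < r) (N : ℕ) :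
    ∃ C : ℝ, 0 < C ∧ ∀ (h : ℝ) (hh : 0 < h), h ≤ 1 → ∀ q ∈ Metric.ball (pt x (-ξ)) r,
      ∀ p : Phase d, 2 * r ≤ dist p (pt x ξ) →
        (1 + ‖p.fst‖ ^ 2 + ‖p.snd‖ ^ 2) ^ N * ‖fbi h (fbiKernel h hh q) p‖ ≤
          C * Real.exp (-(r ^ 2 / 16) * h⁻¹) := by
  set R := ‖x‖ + ‖ξ‖ + 2 * r with hR
  obtain ⟨D, hD⟩ := pow_mul_gauss_bounded (1 / 8) (by norm_num) R (by positivity) (2 * N)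
  obtain ⟨C', hC', H'⟩ := inv_pow_mul_exp_le d (δ := r ^ 2 / 8) (by positivity)
  have hD0 : 0 < D := lt_of_lt_of_le (by positivity) (hD 0 le_rfl)
  refine ⟨2 ^ N * Real.pi ^ ((d : ℝ) / 2) * D * C', by positivity, fun h hh hh1 q hq p hp => ?_⟩
  have hinv : 1 ≤ h⁻¹ := (one_le_inv₀ hh).2 hh1
  set q' := pt q.fst (-q.snd) with hq'
  have hqd : dist q' (pt x ξ) < r := by
    rw [← dist_pt_neg, neg_neg]
    exact hq
  set t := dist p q' with ht
  have ht0 : 0 ≤ t := dist_nonneg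
  have hrt : r ≤ t := by
    have := dist_triangle p q' (pt x ξ)
    linarith
  have ht2 : ‖p.fst - q.fst‖ ^ 2 + ‖p.snd + q.snd‖ ^ 2 = t ^ 2 := by
    rw [ht, dist_sq_eq, hq', pt_fst, pt_snd, sub_neg_eq_add]
  have hw : 1 + ‖p.fst‖ ^ 2 + ‖p.snd‖ ^ 2 ≤ 2 * (1 + R + t) ^ 2 := by
    have e1 : ‖p.fst - q.fst‖ ≤ t := norm_fst_sub_le_dist p q'
    have e2 : ‖p.snd - -q.snd‖ ≤ t := norm_snd_sub_le_dist p q'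
    have e3 : ‖q.fst - x‖ ≤ r := (norm_fst_sub_le_dist q' (pt x ξ)).trans hqd.le
    have e4 : ‖-q.snd - ξ‖ ≤ r := (norm_snd_sub_le_dist q' (pt x ξ)).trans hqd.le
    have e5 := norm_le_norm_add_norm_sub' p.fst q.fst
    have e6 := norm_le_norm_add_norm_sub' p.snd (-q.snd)
    have e7 := norm_le_norm_add_norm_sub' q.fst x
    have e8 := norm_le_norm_add_norm_sub' (-q.snd) ξ
    have f1 : ‖p.fst‖ ≤ R + t := by linarith [norm_nonneg ξ]
    have f2 : ‖p.snd‖ ≤ R + t := by linarith [norm_nonneg x]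
    have g1 : ‖p.fst‖ ^ 2 ≤ (R + t) ^ 2 := pow_le_pow_left₀ (norm_nonneg _) f1 2
    have g2 : ‖p.snd‖ ^ 2 ≤ (R + t) ^ 2 := pow_le_pow_left₀ (norm_nonneg _) f2 2
    have : 0 ≤ R + t := by positivity
    nlinarith
  have hexp : Real.exp (-(t ^ 2) / 4 * h⁻¹) ≤
      Real.exp (-(1 / 8) * t ^ 2) * Real.exp (-(r ^ 2 / 8) * h⁻¹) := by
    rw [← Real.exp_add]
    refine Real.exp_le_exp.2 ?_
    have e1 : r ^ 2 * h⁻¹ ≤ t ^ 2 * h⁻¹ := by gcongr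
    have e2 : t ^ 2 ≤ t ^ 2 * h⁻¹ := le_mul_of_one_le_right (by positivity) hinv
    linarith
  have hpi : (Real.pi * h) ^ ((d : ℝ) / 2) ≤ Real.pi ^ ((d : ℝ) / 2) :=
    Real.rpow_le_rpow (by positivity) (mul_le_of_le_one_right Real.pi_pos.le hh1) (by positivity)
  have hα := fbiConst_le (d := d) hh hh1
  have hα0 := fbiConst_nonneg (d := d) hh
  rw [norm_fbi_fbiKernel, ht2]
  calc _ ≤ (2 * (1 + R + t) ^ 2) ^ N * (h⁻¹ ^ d * Real.pi ^ ((d : ℝ) / 2) *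
        (Real.exp (-(1 / 8) * t ^ 2) * Real.exp (-(r ^ 2 / 8) * h⁻¹))) := by
        gcongr
    _ = 2 ^ N * Real.pi ^ ((d : ℝ) / 2) * ((1 + R + t) ^ (2 * N) * Real.exp (-(1 / 8) * t ^ 2)) *
        (h⁻¹ ^ d * Real.exp (-(r ^ 2 / 8) * h⁻¹)) := by
        rw [mul_pow, ← pow_mul]; ring
    _ ≤ 2 ^ N * Real.pi ^ ((d : ℝ) / 2) * D * (C' * Real.exp (-(r ^ 2 / 8 / 2) * h⁻¹)) := by
        exact mul_le_mul (mul_le_mul_of_nonneg_left (hD t ht0) (by positivity)) (H' h hh)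
          (by positivity) (by positivity)
    _ = _ := by
        have : r ^ 2 / 8 / 2 = r ^ 2 / 16 := by ring
        rw [this]
        ring

/-- The full kernel is handled by its explicit transform and the tail by `fbi_decay`. The rate does
not depend on `ε`, because the estimates already hold everywhere outside the ball. -/
theorem unifMicrosupportedIn_truncatedKernel (hr : 0 < r)
    (hχ : ∀ y ∈ Metric.ball x (r + 1), χ y = 1)
    (hP : ∀ h, 0 < h → h ≤ 1 → P h ∈ Metric.ball (pt x (-ξ)) r) :
    UnifMicrosupportedIn (truncatedKernel χ P) (Metric.ball (pt x ξ) (2 * r)) := by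
  intro ε _
  set δ := min (r ^ 2 / 16) (1 / 8) with hδ
  refine ⟨δ, lt_min (by positivity) (by norm_num), fun N => ?_⟩
  obtain ⟨C₁, hC₁, H₁⟩ := exists_fbi_fbiKernel_le (x := x) (ξ := ξ) hr N
  obtain ⟨C₂, M, hC₂, H₂⟩ := fbi_decay (d := d) N
  obtain ⟨C₃, hC₃, H₃⟩ := exists_kernelTail_le χ x ξ hr hχ _ (continuous_supSeminorm M) M
  refine ⟨C₁ + C₂ * C₃, by positivity, fun h hh hh1 p hp => ?_⟩
  have hp' : 2 * r ≤ dist p (pt x ξ) := le_dist_of_infEDist_pos hp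
  have h1 := H₁ h hh hh1 (P h) (hP h hh hh1) p hp'
  have h2 := (H₂ h hh hh1 (kernelTail χ hh (P h)) p).trans
    (mul_le_mul_of_nonneg_left (H₃ h hh hh1 (P h) (hP h hh hh1)) hC₂.le)
  have e1 : Real.exp (-(r ^ 2 / 16) * h⁻¹) ≤ Real.exp (-δ * h⁻¹) :=
    Real.exp_le_exp.2 (mul_le_mul_of_nonneg_right (neg_le_neg (min_le_left _ _)) (by positivity))
  have e2 : Real.exp (-(1 / 8) * h⁻¹) ≤ Real.exp (-δ * h⁻¹) :=
    Real.exp_le_exp.2 (mul_le_mul_of_nonneg_right (neg_le_neg (min_le_right _ _)) (by positivity))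
  rw [norm_mul, Complex.norm_real, Real.norm_of_nonneg (by positivity), truncatedKernel_eq hh,
    fbi_sub h hh]
  calc _ ≤ (1 + ‖p.fst‖ ^ 2 + ‖p.snd‖ ^ 2) ^ N * (‖fbi h (fbiKernel h hh (P h)) p‖ +
        ‖fbi h (kernelTail χ hh (P h)) p‖) := by
        gcongr
        exact norm_sub_le _ _
    _ = (1 + ‖p.fst‖ ^ 2 + ‖p.snd‖ ^ 2) ^ N * ‖fbi h (fbiKernel h hh (P h)) p‖ +
        (1 + ‖p.fst‖ ^ 2 + ‖p.snd‖ ^ 2) ^ N * ‖fbi h (kernelTail χ hh (P h)) p‖ := by ring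
    _ ≤ C₁ * Real.exp (-(r ^ 2 / 16) * h⁻¹) + C₂ * (C₃ * Real.exp (-(1 / 8) * h⁻¹)) :=
        add_le_add h1 h2
    _ ≤ C₁ * Real.exp (-δ * h⁻¹) + C₂ * (C₃ * Real.exp (-δ * h⁻¹)) := by gcongr
    _ = _ := by ring

end TruncatedKernel

/-! ### Testing on truncated kernels -/

/-- The supremum need not be attained; a factor of two makes up for this, and if the supremum is not
positive any point serves. -/
theorem exists_near_maximizer {α : Type*} {s : Set α} (hs : s.Nonempty) (φ : α → ℝ)
    (hφ : ∀ a, 0 ≤ φ a) {B : ℝ} (hB : ∀ a ∈ s, φ a ≤ B) :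
    ∃ a ∈ s, ∀ b ∈ s, φ b ≤ 2 * φ a := by
  have hbdd : BddAbove (φ '' s) := ⟨B, by rintro _ ⟨a, ha, rfl⟩; exact hB a ha⟩
  have hle : ∀ b ∈ s, φ b ≤ sSup (φ '' s) := fun b hb => le_csSup hbdd ⟨b, hb, rfl⟩
  obtain ⟨a₀, ha₀⟩ := hs
  rcases le_or_gt (sSup (φ '' s)) 0 with h0 | h0
  · exact ⟨a₀, ha₀, fun b hb => (hle b hb).trans (h0.trans (by linarith [hφ a₀]))⟩
  · obtain ⟨_, ⟨a, ha, rfl⟩, hlt⟩ := exists_lt_of_lt_csSup (s := φ '' s) ⟨_, a₀, ha₀, rfl⟩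
      (half_lt_self h0)
    exact ⟨a, ha, fun b hb => (hle b hb).trans (by linarith)⟩

/-- The centres `P h` nearly maximise the transform of `u` over the ball, so the rate obtained from
this single family bounds the transform at all points of the ball simultaneously. -/
theorem notMem_microsupport_of_isBigO {u : ℝ → 𝓢'(Conf d, V)} (hu : PolyBddDist u)
    {x ξ : Conf d} {ε : ℝ} (hε : 0 < ε)
    (H : ∀ f : ℝ → 𝓢(Conf d, ℂ), PolyBddTest f →
      UnifMicrosupportedIn f (Metric.ball (pt x ξ) ε) → ∃ δ : ℝ, 0 < δ ∧
        (fun h : ℝ => u h (f h)) =O[𝓝[>] (0 : ℝ)] fun h : ℝ => Real.exp (-δ * h⁻¹)) :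
    pt x (-ξ) ∉ microsupport u := by
  set r := ε / 2 with hr
  have hr0 : 0 < r := by positivity
  have hr2 : 2 * r = ε := by rw [hr]; ring
  obtain ⟨C₁, M₁, hC₁, H₁⟩ := hu.fbiDist_le
  obtain ⟨C₂, M₂, hC₂, H₂⟩ := hu.exists_bound
  obtain ⟨χ, hχs, hχ⟩ := exists_cutoff x hr0
  set R := 1 + (‖x‖ + r) + (‖ξ‖ + r) with hR
  have hbd : ∀ (h : ℝ) (hh : 0 < h), h ≤ 1 → ∀ p ∈ Metric.ball (pt x (-ξ)) r,
      ‖fbiDist h hh (u h) p‖ ≤ C₁ * (h⁻¹ * R) ^ M₁ := by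
    intro h hh hh1 p hp
    refine (H₁ h hh hh1 p).trans ?_
    have : 1 + ‖p.fst‖ + ‖p.snd‖ ≤ R := one_add_norm_le_of_mem_ball hp
    gcongr
  have hchoice : ∀ h : ℝ, ∃ p : Phase d, p ∈ Metric.ball (pt x (-ξ)) r ∧ ∀ hh : 0 < h, h ≤ 1 →
      ∀ q ∈ Metric.ball (pt x (-ξ)) r,
        ‖fbiDist h hh (u h) q‖ ≤ 2 * ‖fbiDist h hh (u h) p‖ := by
    intro h
    by_cases hh : 0 < h ∧ h ≤ 1
    · obtain ⟨p, hp, hmax⟩ := exists_near_maximizer (s := Metric.ball (pt x (-ξ)) r)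
        ⟨_, Metric.mem_ball_self hr0⟩ (fun p => ‖fbiDist h hh.1 (u h) p‖)
        (fun _ => norm_nonneg _) (hbd h hh.1 hh.2)
      exact ⟨p, hp, fun _ _ => hmax⟩
    · exact ⟨_, Metric.mem_ball_self hr0, fun h1 h2 => absurd ⟨h1, h2⟩ hh⟩
  choose P hP hmax using hchoice
  obtain ⟨δ₀, hδ₀, hO⟩ := H (truncatedKernel χ P)
    (polyBddTest_truncatedKernel hr0 hχs hχ fun h _ _ => hP h)
    (hr2 ▸ unifMicrosupportedIn_truncatedKernel hr0 hχ fun h _ _ => hP h)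
  obtain ⟨c, hc, hbound⟩ := hO.exists_pos
  obtain ⟨h₀, hh₀, hsmall⟩ := mem_nhdsGT_iff_exists_Ioo_subset.1 hbound.bound
  obtain ⟨C₃, hC₃, H₃⟩ := exists_kernelTail_le χ x ξ hr0 hχ _ (continuous_supSeminorm M₂) M₂
  set δ := min δ₀ (1 / 8) with hδ
  have hδ0 : 0 < δ := lt_min hδ₀ (by norm_num)
  obtain ⟨C₄, hC₄, H₄⟩ := inv_pow_mul_exp_le d hδ0
  have hh₀' : (0 : ℝ) < h₀ := hh₀
  set A := 2 * ((c + C₂ * C₃) * C₄) with hA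
  -- The asymptotic bound only reaches `h < h₀`. On `h₀ ≤ h ≤ 1` the polynomial bound is a constant,
  -- and the exponential factor in `A'` offsets the required decay.
  set A' := C₁ * (h₀⁻¹ * R) ^ M₁ * Real.exp (δ / 2 * h₀⁻¹) with hA'
  have hR0 : 0 < R := by positivity
  simp only [microsupport, Set.mem_compl_iff, not_not, Set.mem_ofPred_eq]
  -- The summand `1` makes the inequality strict, as the microsupport requires.
  refine ⟨A + A' + 1, δ / 2, by positivity, by positivity, ?_⟩
  filter_upwards [Metric.ball_mem_nhds (pt x (-ξ)) hr0] with p hp h hh hh1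
  have hA0 : 0 < A := by positivity
  have hA'0 : 0 < A' := by positivity
  have hE : 0 < Real.exp (-(δ / 2) * h⁻¹) := Real.exp_pos _
  suffices hs : ‖fbiDist h hh (u h) p‖ ≤ (A + A') * Real.exp (-(δ / 2) * h⁻¹) by
    exact hs.trans_lt (mul_lt_mul_of_pos_right (by linarith) hE)
  rcases lt_or_ge h h₀ with hlt | hge
  · have h1 : ‖u h (truncatedKernel χ P h)‖ ≤ c * Real.exp (-δ₀ * h⁻¹) := by
      have := hsmall ⟨hh, hlt⟩
      simpa [abs_of_pos] using this
    have h2 : ‖u h (kernelTail χ hh (P h))‖ ≤ C₂ * (C₃ * Real.exp (-(1 / 8) * h⁻¹)) :=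
      (H₂ h hh hh1 _).trans (mul_le_mul_of_nonneg_left (H₃ h hh hh1 (P h) (hP h)) hC₂.le)
    have e1 : Real.exp (-δ₀ * h⁻¹) ≤ Real.exp (-δ * h⁻¹) :=
      Real.exp_le_exp.2 (mul_le_mul_of_nonneg_right (neg_le_neg (min_le_left _ _)) (by positivity))
    have e2 : Real.exp (-(1 / 8) * h⁻¹) ≤ Real.exp (-δ * h⁻¹) :=
      Real.exp_le_exp.2 (mul_le_mul_of_nonneg_right (neg_le_neg (min_le_right _ _)) (by positivity))
    have h3 : fbiKernel h hh (P h) = truncatedKernel χ P h + kernelTail χ hh (P h) := by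
      rw [truncatedKernel_eq hh, sub_add_cancel]
    have h4 : ‖fbiDist h hh (u h) (P h)‖ ≤ (c + C₂ * C₃) * (h⁻¹ ^ d * Real.exp (-δ * h⁻¹)) := by
      rw [fbiDist, norm_smul, Complex.norm_real, Real.norm_of_nonneg (fbiConst_nonneg hh), h3,
        map_add]
      calc _ ≤ h⁻¹ ^ d * (c * Real.exp (-δ * h⁻¹) + C₂ * (C₃ * Real.exp (-δ * h⁻¹))) := by
            refine mul_le_mul (fbiConst_le hh hh1) ((norm_add_le _ _).trans (add_le_add
              (h1.trans (by gcongr)) (h2.trans (by gcongr)))) (norm_nonneg _) (by positivity)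
        _ = _ := by ring
    calc _ ≤ 2 * ‖fbiDist h hh (u h) (P h)‖ := hmax h hh hh1 p hp
      _ ≤ 2 * ((c + C₂ * C₃) * (C₄ * Real.exp (-(δ / 2) * h⁻¹))) := by
          gcongr
          exact h4.trans (mul_le_mul_of_nonneg_left (H₄ h hh) (by positivity))
      _ = A * Real.exp (-(δ / 2) * h⁻¹) := by rw [hA]; ring
      _ ≤ _ := by
          gcongr
          linarith
  · have h1 : h⁻¹ ≤ h₀⁻¹ := inv_anti₀ hh₀' hge
    have h2 : 1 ≤ Real.exp (δ / 2 * h₀⁻¹) * Real.exp (-(δ / 2) * h⁻¹) := by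
      rw [← Real.exp_add]
      refine Real.one_le_exp ?_
      have : δ / 2 * h⁻¹ ≤ δ / 2 * h₀⁻¹ := by gcongr
      linarith
    calc _ ≤ C₁ * (h⁻¹ * R) ^ M₁ := hbd h hh hh1 p hp
      _ ≤ C₁ * (h₀⁻¹ * R) ^ M₁ := by gcongr
      _ ≤ C₁ * (h₀⁻¹ * R) ^ M₁ * (Real.exp (δ / 2 * h₀⁻¹) * Real.exp (-(δ / 2) * h⁻¹)) :=
          le_mul_of_one_le_right (by positivity) h2
      _ = A' * Real.exp (-(δ / 2) * h⁻¹) := by rw [hA']; ring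
      _ ≤ _ := by
          gcongr
          linarith

end Microlocal

end

/-! ### The equivalence -/

theorem mainTheorem9 {d : ℕ} {V : Type*} [NormedAddCommGroup V] [NormedSpace ℂ V] [CompleteSpace V]
    (u : ℝ → 𝓢'(Microlocal.Conf d, V)) (hu : Microlocal.PolyBddDist u)
    (x ξ : Microlocal.Conf d) :
    Microlocal.pt x (-ξ) ∉ Microlocal.microsupport u ↔
      ∃ ε : ℝ, 0 < ε ∧ ∀ f : ℝ → 𝓢(Microlocal.Conf d, ℂ),
        Microlocal.PolyBddTest f →
        Microlocal.UnifMicrosupportedIn f (Metric.ball (Microlocal.pt x ξ) ε) →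
        ∃ δ : ℝ, 0 < δ ∧
          (fun h : ℝ => u h (f h)) =O[𝓝[>] (0 : ℝ)] fun h : ℝ => Real.exp (-δ * h⁻¹) := by
  constructor
  · intro hx
    obtain ⟨ε, hε, H⟩ := Microlocal.isBigO_of_notMem_microsupport hu hx
    exact ⟨ε, hε, fun f hf => H f hf.2⟩
  · rintro ⟨ε, hε, H⟩
    exact Microlocal.notMem_microsupport_of_isBigO hu hε H
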